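/- Let $d\in\mathbb N$, let $\mathbb F^d$ be the free monoid of words in the letters $1,\dots,d$ (with unit $\emptyset$), and let $F^2_d=\ell^2(\mathbb F^d)$ be the full Fock space, with orthonormal basis $\{e_\alpha\}$, vacuum vector $1=e_\emptyset$, left creation operators $L_ke_\alpha=e_{k\alpha}$, $L^\alpha=L_{i_1}\cdots L_{i_m}$ for $\alpha=i_1\cdots i_m$, and transpose unitary $U_\dagger e_\alpha=e_{\alpha^\dagger}$, where $\alpha^\dagger$ is the reversed word. Inner products are conjugate linear in the first argument. Let $\mathcal A_d$ be the norm closure of $\mathrm{span}\{L^\alpha\}$ and let $\mathcal A_d+\mathcal A_d^*$ denote (with norm closure) the free disk operator system. A linear functional on it is positive if it is non-negative on the positive semi-definite operators in the system. Let $\mathbb B^d_n$ be the set of $Z=(Z_1,\dots,Z_d)\in(\mathbb C^{n\times n})^d$ with $\|[Z_1\cdots Z_d]\|<1$. A free function on $\mathbb B^d_{\mathbb N}=\bigsqcup_n\mathbb B^d_n$ is a graded function $f:\mathbb B^d_n\to\mathbb C^{n\times n}$ such that $f(Z)X=Xf(W)$ whenever $ZX=XW$. Identify $f=\sum_\alpha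 f_\alpha e_\alpha\in F^2_d$ with the free function $f(Z)=\sum_\alpha f_\alpha Z^\alpha$. The left free Schur class $\mathscr L_d$ is the set of free functions $B$ on $\mathbb B^d_{\mathbb N}$ for which $f\mapsto Bf$ (pointwise product) maps $F^2_d$ contractively into itself. For $B\in\mathscr L_d$ with $B\not\equiv 1$, $I-B(Z)$ is invertible for every $Z\in\mathbb B^d_{\mathbb N}$; put $H_B(Z)=(I+B(Z))(I-B(Z))^{-1}$. Let $H_B(L)$ be the operator of left multiplication by $H_B$ on the domain $\{f\in F^2_d: H_Bf\in F^2_d\}$, and $H_A(R)=U_\dagger H_B(L)U_\dagger^*$ $(A=B^\dagger)$. This operator is densely defined, every $L^\alpha1$ lies in the domain of $H_A(R)^*$, and there is a unique continuous self-adjoint linear functional $\mu_B$ on $\mathcal A_d+\mathcal A_d^*$ (the Clark functional of $B$) with $$\mu_B(L^\alpha)=\tfrac12\Big(\langle H_A(R)^*1,L^\alpha1\rangle+\langle1,H_A(R)^*L^\alpha1\rangle\Big),\qquad\alpha\in\mathbb F^d;$$ it is positive. **Theorem.** The map $B\mapsto\mu_B$ from $\{B\in\mathscr L_d: B\not\equiv1\}$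 to the positive linear functionals on $\mathcal A_d+\mathcal A_d^*$ is onto, and it is a bijection modulo imaginary constants: $\mu_B=\mu_{B'}$ if and only if there is $t\in\mathbb R$ with $H_B(Z)=H_{B'}(Z)+it\,I_n$ for all $n$ and all $Z\in\mathbb B^d_n$. Moreover $B\mapsto(\mu_B,\operatorname{Im}H_B(0_1))$ is a bijection onto the set of pairs of a positive linear functional and a real number. For every such $B$, every $n$ and every $Z\in\mathbb B^d_n$, with $ZL^*=Z_1\otimes L_1^*+\dots+Z_d\otimes L_d^*$, the operator $I-ZL^*$ is invertible, $(I+ZL^*)(I-ZL^*)^{-1}\in\mathbb C^{n\times n}\otimes(\mathcal A_d+\mathcal A_d^*)$, and the free Herglotz formula holds: $$H_B(Z)=i\operatorname{Im}H_B(0_n)+(\mathrm{id}_n\otimes\mu_B)\big((I+ZL^*)(I-ZL^*)^{-1}\big).$$ -/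

import Mathlib

noncomputable section

namespace FreeClark

open scoped InnerProductSpace

/-! ### The full Fock space and the left free shift -/

/-- Words in `d` letters: the free monoid on `d` generators. -/
abbrev Word (d : ℕ) : Type := FreeMonoid (Fin d)

instance (d : ℕ) : DecidableEq (Word d) :=
  inferInstanceAs (DecidableEq (List (Fin d)))

/-- The full Fock space over `ℂ^d`, realised as `ℓ²` of the free monoid on `d` letters. -/
abbrev Fock (d : ℕ) : Type := lp (fun _ : Word d => ℂ) 2

/-- The canonical orthonormal basis vector `e_α`. -/
def basisVec {d : ℕ} (α : Word d) : Fock d := lp.single 2 α (1 : ℂ)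

/-- The vacuum vector `1 = e_∅`. -/
def vacuum (d : ℕ) : Fock d := basisVec 1

theorem basisVec_orthonormal (d : ℕ) : Orthonormal ℂ (basisVec : Word d → Fock d) := by
  rw [orthonormal_iff_ite]
  intro i j
  rw [basisVec, lp.inner_single_left, basisVec, lp.single_apply]
  by_cases h : i = j
  · subst h; simp
  · simp [h]

/-- The isometry of the Fock space with `e_α ↦ e_{g α}`, for an injective map `g` of words. -/
def wordIsometry {d : ℕ} (g : Word d → Word d) (hg : Function.Injective g) :
    Fock d →ₗᵢ[ℂ] Fock d :=
  ((basisVec_orthonormal d).comp g hg).orthogonalFamily.linearIsometry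

theorem wordIsometry_basisVec {d : ℕ} (g : Word d → Word d) (hg : Function.Injective g)
    (α : Word d) : wordIsometry g hg (basisVec α) = basisVec (g α) := by
  rw [wordIsometry, basisVec, OrthogonalFamily.linearIsometry_apply_single]
  simp

/-- The left creation operators `L_k`, with `L_k e_α = e_{kα}`. -/
def leftShift {d : ℕ} (k : Fin d) : Fock d →L[ℂ] Fock d :=
  (wordIsometry (fun α => FreeMonoid.of k * α)
    (fun _ _ h => mul_left_cancel h)).toContinuousLinearMap

/-- `L^α = L_{i₁} ⋯ L_{iₙ}` for the word `α = i₁ ⋯ iₙ`. -/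
def leftMonomial {d : ℕ} (α : Word d) : Fock d →L[ℂ] Fock d :=
  FreeMonoid.lift leftShift α

/-- The transpose unitary `U_†`, with `U_† e_α = e_{α†}`, where `α†` is the reversed word. -/
def transposeUnitary (d : ℕ) : Fock d →L[ℂ] Fock d :=
  (wordIsometry (FreeMonoid.reverse : Word d → Word d)
    (fun _ _ h => by simpa using congrArg FreeMonoid.reverse h)).toContinuousLinearMap

/-! ### The free disk operator system and its positive functionals -/

/-- The free disk algebra: the norm closure of the linear span of the `L^α`. -/
def diskAlgebra (d : ℕ) : Submodule ℂ (Fock d →L[ℂ] Fock d) :=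
  (Submodule.span ℂ (Set.range (leftMonomial : Word d → Fock d →L[ℂ] Fock d))).topologicalClosure

/-- The set of adjoints of elements of the free disk algebra. -/
def diskAlgebraStar (d : ℕ) : Submodule ℂ (Fock d →L[ℂ] Fock d) where
  carrier := {T | star T ∈ diskAlgebra d}
  zero_mem' := by simp
  add_mem' {S T} hS hT := by
    have := (diskAlgebra d).add_mem hS hT
    simpa using this
  smul_mem' c T hT := by
    have := (diskAlgebra d).smul_mem (star c) hT
    simpa using this

/-- The free disk operator system: the norm closure of `𝒜_d + 𝒜_d^*`. -/
def diskSystem (d : ℕ) : Submodule ℂ (Fock d →L[ℂ] Fock d) :=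
  (diskAlgebra d ⊔ diskAlgebraStar d).topologicalClosure

theorem leftMonomial_mem {d : ℕ} (α : Word d) : leftMonomial α ∈ diskSystem d :=
  Submodule.le_topologicalClosure _ (Submodule.mem_sup_left
    (Submodule.le_topologicalClosure _ (Submodule.subset_span ⟨α, rfl⟩)))

/-- Positive linear functionals on the free disk system: linear functionals taking non-negative
real values at the positive semi-definite operators in the system. -/
def PositiveFunctional (d : ℕ) : Type :=
  {μ : diskSystem d →ₗ[ℂ] ℂ //
    ∀ T : diskSystem d, (T : Fock d →L[ℂ] Fock d).IsPositive → 0 ≤ (μ T).re ∧ (μ T).im = 0}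

/-! ### The non-commutative unit ball and free functions -/

open scoped Matrix.Norms.L2Operator in
/-- Level `n` of the open NC unit ball: `d`-tuples `Z = (Z_1, …, Z_d)` of `n × n` matrices such that
the row `[Z_1 ⋯ Z_d] : ℂⁿ ⊗ ℂ^d → ℂⁿ` has operator norm `< 1`. -/
def NCBall (d n : ℕ) : Type :=
  {Z : Fin d → Matrix (Fin n) (Fin n) ℂ //
    ‖(Matrix.of fun i (p : Fin d × Fin n) => Z p.1 i p.2 : Matrix (Fin n) (Fin d × Fin n) ℂ)‖ < 1}

open scoped Matrix.Norms.L2Operator in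
/-- The origin `0_n` of level `n` of the NC unit ball. -/
def NCBall.zero (d n : ℕ) : NCBall d n :=
  ⟨fun _ => 0, by
    have : (Matrix.of fun (i : Fin n) (p : Fin d × Fin n) =>
        (0 : Matrix (Fin n) (Fin n) ℂ) i p.2) = (0 : Matrix (Fin n) (Fin d × Fin n) ℂ) := rfl
    rw [this, norm_zero]; exact one_pos⟩

/-- `Z^α = Z_{i₁} ⋯ Z_{iₙ}` for the word `α = i₁ ⋯ iₙ`. -/
def NCBall.monomial {d n : ℕ} (Z : NCBall d n) (α : Word d) : Matrix (Fin n) (Fin n) ℂ :=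
  FreeMonoid.lift Z.1 α

/-- Free (NC) functions on the NC unit ball: graded functions that respect intertwinings.
(The vacuous level `n = 0` is included for convenience; it carries no information.) -/
@[ext]
structure FreeFunction (d : ℕ) where
  /-- The value at a point of level `n`. -/
  val : ∀ n : ℕ, NCBall d n → Matrix (Fin n) (Fin n) ℂ
  /-- If `Z X = X W` then `f(Z) X = X f(W)`. -/
  intertwines : ∀ (n m : ℕ) (X : Matrix (Fin n) (Fin m) ℂ) (Z : NCBall d n) (W : NCBall d m),
    (∀ k, Z.1 k * X = X * W.1 k) → val n Z * X = X * val m W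

/-- The constant free function `1`. -/
instance (d : ℕ) : One (FreeFunction d) :=
  ⟨{ val := fun _ _ => 1, intertwines := fun _ _ X _ _ _ => by rw [Matrix.one_mul, Matrix.mul_one] }⟩

/-- `f(Z) = F`, where the vector `f = ∑ f_α e_α` of the Fock space is viewed as the element
`f(Z) = ∑ f_α Z^α` of the free Hardy space. -/
def HasValue {d n : ℕ} (f : Fock d) (Z : NCBall d n) (F : Matrix (Fin n) (Fin n) ℂ) : Prop :=
  HasSum (fun α : Word d => f α • Z.monomial α) F

/-- The free Hardy space function `g` is the pointwise product `G f` on the NC unit ball. -/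
def IsLeftProduct {d : ℕ} (G : ∀ n : ℕ, NCBall d n → Matrix (Fin n) (Fin n) ℂ) (f g : Fock d) :
    Prop :=
  ∀ (n : ℕ) (Z : NCBall d n), ∃ F, HasValue f Z F ∧ HasValue g Z (G n Z * F)

/-- The left free Schur class: the closed unit ball of the left multiplier algebra of the free
Hardy space, i.e. the free functions `B` such that `f ↦ B f` maps the free Hardy space into itself
contractively. -/
def schurClass (d : ℕ) : Set (FreeFunction d) :=
  {B | ∀ f : Fock d, ∃ g : Fock d, IsLeftProduct B.val f g ∧ ‖g‖ ≤ ‖f‖}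

/-- The left free Schur class without the constant function `1`, whose Cayley transform does not
exist. -/
def CayleySchur (d : ℕ) : Type := {B : FreeFunction d // B ∈ schurClass d ∧ B ≠ 1}

/-- The Cayley transform `H_B(Z) = (I + B(Z)) (I - B(Z))⁻¹`. -/
def herglotz {d : ℕ} (B : FreeFunction d) (n : ℕ) (Z : NCBall d n) : Matrix (Fin n) (Fin n) ℂ :=
  (1 + B.val n Z) * (1 - B.val n Z)⁻¹

/-! ### The Clark functional -/

/-- The graph of the operator `H(L)` of left multiplication by `H` in the free Hardy space, on its
maximal domain `{f : H f belongs to the free Hardy space}`. -/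
def leftMulGraph {d : ℕ} (H : ∀ n : ℕ, NCBall d n → Matrix (Fin n) (Fin n) ℂ) :
    Submodule ℂ (Fock d × Fock d) where
  carrier := {p | IsLeftProduct H p.1 p.2}
  zero_mem' := fun n Z => ⟨0, by simp [HasValue, hasSum_zero]⟩
  add_mem' {p q} hp hq := fun n Z => by
    obtain ⟨F, hF, hF'⟩ := hp n Z
    obtain ⟨G, hG, hG'⟩ := hq n Z
    refine ⟨F + G, ?_, ?_⟩
    · simpa [HasValue, add_smul] using HasSum.add hF hG
    · simpa [HasValue, add_smul, mul_add] using HasSum.add hF' hG'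
  smul_mem' c p hp := fun n Z => by
    obtain ⟨F, hF, hF'⟩ := hp n Z
    refine ⟨c • F, ?_, ?_⟩
    · simpa [HasValue, smul_smul] using HasSum.const_smul c hF
    · simpa [HasValue, smul_smul] using HasSum.const_smul c hF'

/-- The graph of `H_A(R) = U_† H_B(L) U_†^*`, where `A = B†`: the pairs `(f, g)` such that
`H_B(L) U_†^* f = U_†^* g`. -/
def rightHerglotzGraph {d : ℕ} (B : FreeFunction d) : Submodule ℂ (Fock d × Fock d) :=
  (leftMulGraph (herglotz B)).comap
    (((transposeUnitary d).adjoint : Fock d →ₗ[ℂ] Fock d).prodMap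
      ((transposeUnitary d).adjoint : Fock d →ₗ[ℂ] Fock d))

/-- The (generally unbounded) operator `H_A(R)`, `A = B†`. -/
def rightHerglotz {d : ℕ} (B : FreeFunction d) : Fock d →ₗ.[ℂ] Fock d :=
  (rightHerglotzGraph B).toLinearPMap

/-- `μ` is the Clark functional `μ_B`: it is continuous and self-adjoint, the vectors `L^α 1` lie in
the domain of `H_A(R)^*`, and
`μ(L^α) = (⟪H_A(R)^* 1, L^α 1⟫ + ⟪1, H_A(R)^* L^α 1⟫) / 2` for every word `α`. -/
structure IsClarkFunctional {d : ℕ} (B : FreeFunction d) (μ : diskSystem d →ₗ[ℂ] ℂ) : Prop where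
  continuous : Continuous μ
  selfAdjoint : ∀ S T : diskSystem d,
    (S : Fock d →L[ℂ] Fock d) = star (T : Fock d →L[ℂ] Fock d) → μ S = star (μ T)
  formula : ∀ α : Word d,
    ∃ (h₁ : vacuum d ∈ (rightHerglotz B).adjoint.domain)
      (h₂ : leftMonomial α (vacuum d) ∈ (rightHerglotz B).adjoint.domain),
      μ ⟨leftMonomial α, leftMonomial_mem α⟩ =
        (1 / 2 : ℂ) * (⟪(rightHerglotz B).adjoint ⟨vacuum d, h₁⟩, leftMonomial α (vacuum d)⟫_ℂ
          + ⟪vacuum d, (rightHerglotz B).adjoint ⟨leftMonomial α (vacuum d), h₂⟩⟫_ℂ)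

/-! ### The Herglotz formula -/

/-- `Z L^* = Z_1 ⊗ L_1^* + ⋯ + Z_d ⊗ L_d^*`, an operator on `ℂⁿ ⊗ F²_d` written as an `n × n` matrix
of operators on the Fock space. -/
def zLstar {d n : ℕ} (Z : NCBall d n) : Matrix (Fin n) (Fin n) (Fock d →L[ℂ] Fock d) :=
  Matrix.of fun i j => ∑ k, Z.1 k i j • (leftShift k).adjoint

end FreeClark

end

/-! Expanding `(I + ZL^*)(I - ZL^*)⁻¹ = I + 2 ∑ Z^α (L^*)^α` over non-empty words shows that the
Herglotz formula only asks for `H_B` to have the coefficients `2 μ((L^*)^α)` and the constant term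
`μ(1) + it`. The theorem is thus a correspondence between coefficient families, and everything is
done with formal series; values at all matrix points determine the series (`series_ext`).

From `μ` to `B`: since `L_k^* L_j = δ_{kj}`, the system contains every product `(L^*)^α
((L^*)^γ)^*`, and `μ` of these products is the Toeplitz kernel of the real part of multiplication by
the Herglotz series `η` (`toeplitz_kernel`). Positivity of `μ` on `P^*P` makes that real part
non-negative, and then `b = (η - 1)(η + 1)⁻¹` is contractive (`isSchurSeries_cayleyInv`).

From `B` to `μ`: after reversing words, `B` becomes a contractive right multiplier `A`. For `s < 1`
the operator `H = (1 + sA)(1 - sA)⁻¹` is bounded with non-negative real part, and `T ↦ Re ⟨1, T H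
1⟩` is the candidate on self-adjoint `T`. The difficulty is its positivity on all `T ≥ 0` in the
system, which need not be sums of squares from the disk algebra. Elements of the system are Toeplitz
for the right shifts. If such a `T` is positive and invertible, the right translates of `T⁻¹1` are
orthogonal for `⟨·, T·⟩`, and they give a left multiplier `W` with dense range and `W^* T W = I`. As
`W` commutes with `H`, `Re ⟨Wf, T H W f⟩ = Re ⟨f, H f⟩ ≥ 0` (`re_inner_toeplitz_mul_nonneg`).
Letting `s → 1` along an ultrafilter gives `μ` (`exists_clark_functional`).

The unbounded operator `H_A(R)` is formal right multiplication by the reversed `η`. Coefficients of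
such a product are continuous in the vector, so each `e_α` is in the domain of the adjoint, and the
Clark formula becomes an identity of coefficients (`isClarkFunctional_iff`). -/

noncomputable section
namespace FreeClark
open scoped InnerProductSpace

/-! ### Formal power series in non-commuting variables -/

/-- Formal power series in `d` non-commuting variables, as families of coefficients. -/
def NCSeries (d : ℕ) : Type := Word d → ℂ

namespace NCSeries

variable {d : ℕ}

instance : AddCommGroup (NCSeries d) := inferInstanceAs (AddCommGroup (Word d → ℂ))
instance : Module ℂ (NCSeries d) := inferInstanceAs (Module ℂ (Word d → ℂ))
instance : TopologicalSpace (NCSeries d) := inferInstanceAs (TopologicalSpace (Word d → ℂ))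
instance : T2Space (NCSeries d) := inferInstanceAs (T2Space (Word d → ℂ))
instance : IsTopologicalAddGroup (NCSeries d) :=
  inferInstanceAs (IsTopologicalAddGroup (Word d → ℂ))
instance : ContinuousSMul ℂ (NCSeries d) := inferInstanceAs (ContinuousSMul ℂ (Word d → ℂ))

@[ext] theorem ext {x y : NCSeries d} (h : ∀ α, x α = y α) : x = y := funext h

@[simp] theorem add_apply (x y : NCSeries d) (α : Word d) : (x + y) α = x α + y α := rfl
@[simp] theorem sub_apply (x y : NCSeries d) (α : Word d) : (x - y) α = x α - y α := rfl
@[simp] theorem neg_apply (x : NCSeries d) (α : Word d) : (-x) α = -x α := rfl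
@[simp] theorem zero_apply (α : Word d) : (0 : NCSeries d) α = 0 := rfl
@[simp] theorem smul_apply (c : ℂ) (x : NCSeries d) (α : Word d) : (c • x) α = c * x α := rfl

theorem sum_apply {ι : Type*} (s : Finset ι) (x : ι → NCSeries d) (α : Word d) :
    (∑ i ∈ s, x i) α = ∑ i ∈ s, x i α := Finset.sum_apply α s x

theorem continuous_apply (α : Word d) : Continuous fun x : NCSeries d => x α :=
  _root_.continuous_apply (A := fun _ : Word d => ℂ) α

theorem continuous_of_apply {X : Type*} [TopologicalSpace X] {f : X → NCSeries d}
    (h : ∀ α, Continuous fun t => f t α) : Continuous f :=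
  continuous_pi (A := fun _ : Word d => ℂ) h

/-- The left derivative of a series by a letter. -/
def lder (k : Fin d) (x : NCSeries d) : NCSeries d := fun α => x (FreeMonoid.of k * α)

/-- The right derivative of a series by a letter. -/
def rder (k : Fin d) (x : NCSeries d) : NCSeries d := fun α => x (α * FreeMonoid.of k)

@[simp] theorem lder_apply (k : Fin d) (x : NCSeries d) (α : Word d) :
    lder k x α = x (FreeMonoid.of k * α) := rfl
@[simp] theorem rder_apply (k : Fin d) (x : NCSeries d) (α : Word d) :
    rder k x α = x (α * FreeMonoid.of k) := rfl

/-- The factorisations of a word into two words. -/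
def splitsList : List (Fin d) → Finset (Word d × Word d)
  | [] => {(1, 1)}
  | k :: α => insert (1, FreeMonoid.ofList (k :: α))
      ((splitsList α).image fun p => (FreeMonoid.of k * p.1, p.2))

/-- The factorisations of a word into two words. -/
def splits (α : Word d) : Finset (Word d × Word d) := splitsList α.toList

theorem splits_one : splits (1 : Word d) = {(1, 1)} := rfl

theorem splits_of_mul (k : Fin d) (α : Word d) : splits (FreeMonoid.of k * α) =
    insert (1, FreeMonoid.of k * α)
      ((splits α).image fun p => (FreeMonoid.of k * p.1, p.2)) := rfl

theorem of_mul_ne_one (k : Fin d) (α : Word d) : FreeMonoid.of k * α ≠ 1 :=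
  List.cons_ne_nil k α

theorem mul_of_ne_one (k : Fin d) (α : Word d) : α * FreeMonoid.of k ≠ 1 :=
  List.append_ne_nil_of_right_ne_nil α (List.cons_ne_nil k [])

theorem of_mul_inj {j k : Fin d} {α β : Word d} :
    FreeMonoid.of j * α = FreeMonoid.of k * β ↔ j = k ∧ α = β :=
  List.cons_eq_cons

theorem mul_of_inj {j k : Fin d} {α β : Word d} :
    α * FreeMonoid.of j = β * FreeMonoid.of k ↔ j = k ∧ α = β := by
  constructor
  · intro h
    obtain ⟨h1, h2⟩ := List.append_inj' (s₁ := α) (s₂ := β) (t₁ := [j]) (t₂ := [k]) h rfl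
    exact ⟨List.singleton_injective h2, h1⟩
  · rintro ⟨rfl, rfl⟩; rfl

theorem mem_splits {α : Word d} {p : Word d × Word d} : p ∈ splits α ↔ p.1 * p.2 = α := by
  induction α using FreeMonoid.inductionOn' generalizing p with
  | one =>
    obtain ⟨β, γ⟩ := p
    rw [splits_one, Finset.mem_singleton, Prod.mk.injEq]
    constructor
    · rintro ⟨rfl, rfl⟩; rfl
    · intro h
      exact List.append_eq_nil_iff.1 h
  | of_mul k α ih =>
    obtain ⟨β, γ⟩ := p
    rw [splits_of_mul, Finset.mem_insert, Finset.mem_image]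
    constructor
    · rintro (h | ⟨q, hq, h⟩)
      · obtain ⟨rfl, rfl⟩ := Prod.mk.inj h
        simp
      · obtain ⟨rfl, rfl⟩ := Prod.mk.inj h
        rw [ih] at hq
        simp [mul_assoc, hq]
    · intro h
      induction β using FreeMonoid.casesOn with
      | one => left; simpa using h
      | of_mul j β =>
        right
        simp only [mul_assoc] at h
        obtain ⟨rfl, h'⟩ := of_mul_inj.1 h
        exact ⟨(β, γ), ih.2 h', rfl⟩

instance : Mul (NCSeries d) := ⟨fun x y α => ∑ p ∈ splits α, x p.1 * y p.2⟩

theorem mul_apply (x y : NCSeries d) (α : Word d) :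
    (x * y) α = ∑ p ∈ splits α, x p.1 * y p.2 := rfl

@[simp] theorem mul_apply_one (x y : NCSeries d) : (x * y) 1 = x 1 * y 1 := by
  simp [mul_apply, splits_one]

/-- Either the left factor of a splitting is empty or it takes the first letter. This recursion
drives the proofs of associativity and of the right unit law. -/
theorem mul_apply_of_mul (x y : NCSeries d) (k : Fin d) (α : Word d) :
    (x * y) (FreeMonoid.of k * α) = x 1 * y (FreeMonoid.of k * α) + (lder k x * y) α := by
  rw [mul_apply, splits_of_mul, Finset.sum_insert, Finset.sum_image]
  · rfl
  · rintro ⟨β, γ⟩ _ ⟨β', γ'⟩ _ h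
    simp only [Prod.mk.injEq, mul_right_inj] at h
    rw [h.1, h.2]
  · simp only [Finset.mem_image, Prod.mk.injEq, not_exists, not_and]
    rintro p _ h
    exact absurd h (of_mul_ne_one _ _)

/-- The unit series. -/
instance : One (NCSeries d) := ⟨fun α => if α = 1 then 1 else 0⟩

theorem one_apply (α : Word d) : (1 : NCSeries d) α = if α = 1 then 1 else 0 := rfl

@[simp] theorem one_apply_one : (1 : NCSeries d) 1 = 1 := if_pos rfl
@[simp] theorem one_apply_of_mul (k : Fin d) (α : Word d) :
    (1 : NCSeries d) (FreeMonoid.of k * α) = 0 := if_neg (of_mul_ne_one k α)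
@[simp] theorem lder_one (k : Fin d) : lder k (1 : NCSeries d) = 0 := by ext; simp

theorem add_mul' (x y z : NCSeries d) : (x + y) * z = x * z + y * z := by
  ext α; simp [mul_apply, add_mul, Finset.sum_add_distrib]

theorem mul_add' (x y z : NCSeries d) : x * (y + z) = x * y + x * z := by
  ext α; simp [mul_apply, mul_add, Finset.sum_add_distrib]

theorem smul_mul' (c : ℂ) (x y : NCSeries d) : (c • x) * y = c • (x * y) := by
  ext α; simp [mul_apply, mul_assoc, Finset.mul_sum]

theorem mul_smul' (c : ℂ) (x y : NCSeries d) : x * (c • y) = c • (x * y) := by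
  ext α; simp [mul_apply, mul_left_comm, Finset.mul_sum]

theorem zero_mul' (x : NCSeries d) : 0 * x = 0 := by
  ext α; simp [mul_apply]

theorem mul_zero' (x : NCSeries d) : x * 0 = 0 := by
  ext α; simp [mul_apply]

theorem lder_mul (k : Fin d) (x y : NCSeries d) :
    lder k (x * y) = x 1 • lder k y + lder k x * y := by
  ext α; simp [mul_apply_of_mul]

theorem mul_assoc' (x y z : NCSeries d) : x * y * z = x * (y * z) := by
  ext α
  induction α using FreeMonoid.inductionOn' generalizing x with
  | one => simp [mul_assoc]
  | of_mul k α ih =>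
    rw [mul_apply_of_mul, mul_apply_of_mul, lder_mul, add_mul', smul_mul', add_apply, smul_apply,
      ih, mul_apply_of_mul, mul_apply_one]
    ring

theorem one_mul' (x : NCSeries d) : 1 * x = x := by
  ext α
  induction α using FreeMonoid.inductionOn' with
  | one => simp
  | of_mul k α ih => simp [mul_apply_of_mul, zero_mul']

theorem mul_one' (x : NCSeries d) : x * 1 = x := by
  ext α
  induction α using FreeMonoid.inductionOn' generalizing x with
  | one => simp
  | of_mul k α ih => simp [mul_apply_of_mul, ih]

instance : Ring (NCSeries d) :=
  { (inferInstance : AddCommGroup (NCSeries d)) with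
    mul := (· * ·)
    one := 1
    left_distrib := mul_add'
    right_distrib := add_mul'
    zero_mul := zero_mul'
    mul_zero := mul_zero'
    mul_assoc := mul_assoc'
    one_mul := one_mul'
    mul_one := mul_one' }

instance : Algebra ℂ (NCSeries d) :=
  Algebra.ofModule smul_mul' (fun c x y => mul_smul' c x y)

theorem continuous_mul {X : Type*} [TopologicalSpace X] {f g : X → NCSeries d}
    (hf : Continuous f) (hg : Continuous g) : Continuous fun t => f t * g t := by
  refine continuous_of_apply fun α => ?_
  simp only [mul_apply]
  refine continuous_finsetSum _ fun p _ => ?_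
  exact ((continuous_apply p.1).comp hf).mul ((continuous_apply p.2).comp hg)

instance : ContinuousMul (NCSeries d) := ⟨continuous_mul continuous_fst continuous_snd⟩
instance : IsTopologicalRing (NCSeries d) where

theorem length_le_of_mem_splits {α : Word d} {p : Word d × Word d} (hp : p ∈ splits α) :
    p.1.length ≤ α.length ∧ p.2.length ≤ α.length := by
  rw [mem_splits] at hp
  rw [← hp, FreeMonoid.length_mul]
  omega

/-- A product coefficient at `α` involves only words no longer than `α`. Hence formal identities can
be checked on truncations, and multiplication respects truncation. -/
theorem mul_congr_of_length_le {x x' y y' : NCSeries d} {α : Word d}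
    (hx : ∀ β : Word d, β.length ≤ α.length → x β = x' β)
    (hy : ∀ β : Word d, β.length ≤ α.length → y β = y' β) : (x * y) α = (x' * y') α := by
  rw [mul_apply, mul_apply]
  refine Finset.sum_congr rfl fun p hp => ?_
  obtain ⟨h1, h2⟩ := length_le_of_mem_splits hp
  rw [hx _ h1, hy _ h2]

/-- Without a constant term, `x ^ m` needs `m` non-empty factors, so only finitely many powers
contribute to a given coefficient. -/
theorem pow_apply_eq_zero {x : NCSeries d} (hx : x 1 = 0) {m : ℕ} {α : Word d}
    (h : α.length < m) : (x ^ m) α = 0 := by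
  induction m generalizing α with
  | zero => simp at h
  | succ m ih =>
    rw [pow_succ, mul_apply]
    refine Finset.sum_eq_zero fun p hp => ?_
    by_cases h2 : p.2 = 1
    · rw [h2, hx, mul_zero]
    · have h3 : p.2.length ≠ 0 := fun h => h2 (FreeMonoid.length_eq_zero.1 h)
      rw [mem_splits] at hp
      rw [← hp, FreeMonoid.length_mul] at h
      rw [ih (by omega), zero_mul]

/-- The sum `∑ x^m` of a formal geometric series, where `x` has no constant term. -/
def geom (x : NCSeries d) : NCSeries d :=
  fun α => (∑ m ∈ Finset.range (α.length + 1), x ^ m) α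

theorem geom_apply {x : NCSeries d} (hx : x 1 = 0) {α : Word d} {N : ℕ} (h : α.length < N) :
    geom x α = (∑ m ∈ Finset.range N, x ^ m) α := by
  rw [geom, sum_apply, sum_apply]
  refine Finset.sum_subset (fun m hm => ?_) (fun m _ hm => ?_)
  · simp only [Finset.mem_range] at hm ⊢; omega
  · simp only [Finset.mem_range, not_lt] at hm
    exact pow_apply_eq_zero hx (by omega)

theorem geom_mul_one_sub {x : NCSeries d} (hx : x 1 = 0) : geom x * (1 - x) = 1 := by
  ext α
  have h : (geom x * (1 - x)) α = ((∑ m ∈ Finset.range (α.length + 1), x ^ m) * (1 - x)) α :=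
    mul_congr_of_length_le (fun β hβ => geom_apply hx (by omega)) (fun _ _ => rfl)
  rw [h, geom_sum_mul_neg, sub_apply, pow_apply_eq_zero hx (by omega), sub_zero]

theorem one_sub_mul_geom {x : NCSeries d} (hx : x 1 = 0) : (1 - x) * geom x = 1 := by
  ext α
  have h : ((1 - x) * geom x) α = ((1 - x) * (∑ m ∈ Finset.range (α.length + 1), x ^ m)) α :=
    mul_congr_of_length_le (fun _ _ => rfl) (fun β hβ => geom_apply hx (by omega))
  rw [h, mul_neg_geom_sum, sub_apply, pow_apply_eq_zero hx (by omega), sub_zero]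

/-- The formal inverse of a series with non-zero constant term. -/
def inv (x : NCSeries d) : NCSeries d := (x 1)⁻¹ • geom (1 - (x 1)⁻¹ • x)

theorem inv_mul {x : NCSeries d} (hx : x 1 ≠ 0) : inv x * x = 1 := by
  have h : (1 - (x 1)⁻¹ • x) 1 = 0 := by simp [hx]
  have := geom_mul_one_sub h
  rw [sub_sub_cancel] at this
  rw [inv, smul_mul_assoc, ← mul_smul_comm, this]

theorem mul_inv {x : NCSeries d} (hx : x 1 ≠ 0) : x * inv x = 1 := by
  have h : (1 - (x 1)⁻¹ • x) 1 = 0 := by simp [hx]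
  have := one_sub_mul_geom h
  rw [sub_sub_cancel] at this
  rw [inv, mul_smul_comm, ← smul_mul_assoc, this]

theorem eq_inv_of_mul_eq_one {x y : NCSeries d} (hx : x 1 ≠ 0) (h : x * y = 1) : y = inv x := by
  rw [← one_mul y, ← inv_mul hx, mul_assoc, h, mul_one]

/-- Each coefficient of the inverse is a polynomial in finitely many coefficients and in `(x 1)⁻¹`.
This permits the limit `s → 1` in the Cayley transform. -/
theorem tendsto_inv {ι : Type*} {l : Filter ι} {f : ι → NCSeries d} {x : NCSeries d}
    (hx : x 1 ≠ 0) (hf : Filter.Tendsto f l (nhds x)) :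
    Filter.Tendsto (fun i => inv (f i)) l (nhds (inv x)) := by
  have h1 : Filter.Tendsto (fun i => (f i 1)⁻¹) l (nhds (x 1)⁻¹) :=
    (((continuous_apply 1).tendsto x).comp hf).inv₀ hx
  refine h1.smul ?_
  have h2 : Filter.Tendsto (fun i => 1 - (f i 1)⁻¹ • f i) l (nhds (1 - (x 1)⁻¹ • x)) :=
    tendsto_const_nhds.sub (h1.smul hf)
  refine tendsto_pi_nhds (A := fun _ : Word d => ℂ) |>.2 fun α => ?_
  have h3 : Continuous fun y : NCSeries d => (∑ m ∈ Finset.range (α.length + 1), y ^ m) α :=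
    (continuous_apply α).comp (continuous_finsetSum _ fun m _ => continuous_pow m)
  exact (h3.tendsto _).comp h2

/-- The series with reversed words. -/
def rev (x : NCSeries d) : NCSeries d := fun α => x α.reverse

@[simp] theorem rev_apply (x : NCSeries d) (α : Word d) : rev x α = x α.reverse := rfl

theorem rev_rev (x : NCSeries d) : rev (rev x) = x := by
  ext α; rw [rev_apply, rev_apply, FreeMonoid.reverse_reverse]

theorem rev_add (x y : NCSeries d) : rev (x + y) = rev x + rev y := rfl
theorem rev_sub (x y : NCSeries d) : rev (x - y) = rev x - rev y := rfl

theorem reverse_one : (1 : Word d).reverse = 1 := rfl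

theorem reverse_eq_one {α : Word d} : α.reverse = 1 ↔ α = 1 := List.reverse_eq_nil_iff

@[simp] theorem rev_apply_one (x : NCSeries d) : rev x 1 = x 1 := rfl

theorem rev_one : rev (1 : NCSeries d) = 1 := by
  ext α; simp [one_apply, reverse_eq_one]

theorem rev_mul (x y : NCSeries d) : rev (x * y) = rev y * rev x := by
  ext α
  rw [rev_apply, mul_apply, mul_apply]
  refine Finset.sum_nbij' (fun p => (p.2.reverse, p.1.reverse))
    (fun p => (p.2.reverse, p.1.reverse)) ?_ ?_ ?_ ?_ ?_
  · intro p hp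
    rw [mem_splits] at hp ⊢
    rw [← FreeMonoid.reverse_mul, hp, FreeMonoid.reverse_reverse]
  · intro p hp
    rw [mem_splits] at hp ⊢
    rw [← FreeMonoid.reverse_mul, hp]
  · intro p _; simp [FreeMonoid.reverse_reverse]
  · intro p _; simp [FreeMonoid.reverse_reverse]
  · intro p _; simp [FreeMonoid.reverse_reverse, mul_comm]

theorem rev_inv {x : NCSeries d} (hx : x 1 ≠ 0) : rev (inv x) = inv (rev x) :=
  eq_inv_of_mul_eq_one (x := rev x) hx (by rw [← rev_mul, inv_mul hx, rev_one])

/-- The mirror image of `mul_apply_of_mul`, carried over by word reversal; Toeplitz arguments strip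
letters from the right. -/
theorem mul_apply_mul_of (x y : NCSeries d) (k : Fin d) (α : Word d) :
    (x * y) (α * FreeMonoid.of k) = x (α * FreeMonoid.of k) * y 1 + (x * rder k y) α := by
  have h := congrFun (rev_mul x y) (FreeMonoid.of k * α.reverse)
  have h1 : rev y 1 = y 1 := rfl
  have h2 : lder k (rev y) = rev (rder k y) := by
    ext β; simp [FreeMonoid.reverse_mul]
  rw [mul_apply_of_mul, h2, ← rev_mul] at h
  simp only [rev_apply, FreeMonoid.reverse_mul, FreeMonoid.reverse_reverse, FreeMonoid.reverse_of,
    reverse_one] at h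
  rw [h, mul_comm]

/-- The series with a single coefficient `1` at the word `γ`. -/
def mono (γ : Word d) : NCSeries d := fun α => if α = γ then 1 else 0

theorem mono_apply (γ α : Word d) : mono γ α = if α = γ then 1 else 0 := rfl

theorem mono_one : mono (1 : Word d) = 1 := rfl

theorem mono_mul_mono (β γ : Word d) : mono β * mono γ = mono (β * γ) := by
  ext α
  rw [mul_apply, mono_apply]
  by_cases h : α = β * γ
  · rw [if_pos h, Finset.sum_eq_single (β, γ)]
    · simp [mono_apply]
    · rintro ⟨p, q⟩ _ hne
      simp only [mono_apply]
      by_cases h1 : p = β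
      · have : q ≠ γ := fun h2 => hne (by rw [h1, h2])
        simp [this]
      · simp [h1]
    · intro h'; exact absurd (mem_splits.2 h.symm) h'
  · rw [if_neg h]
    refine Finset.sum_eq_zero fun p hp => ?_
    rw [mem_splits] at hp
    simp only [mono_apply]
    by_cases h1 : p.1 = β
    · have : p.2 ≠ γ := fun h2 => h (by rw [← hp, h1, h2])
      simp [this]
    · simp [h1]

theorem mono_mul_apply_mul (β α : Word d) (x : NCSeries d) : (mono β * x) (β * α) = x α := by
  rw [mul_apply, Finset.sum_eq_single (β, α)]
  · simp [mono_apply]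
  · rintro ⟨p, q⟩ hp hne
    rw [mem_splits] at hp
    simp only [mono_apply]
    by_cases h1 : p = β
    · subst h1
      have h2 : q = α := mul_left_cancel hp
      exact absurd (by rw [h2]) hne
    · simp [h1]
  · intro h'; exact absurd (mem_splits.2 rfl) h'

end NCSeries
end FreeClark
end

/-! ### Convergence of series on the ball and uniqueness of coefficients. -/

noncomputable section
namespace FreeClark
open scoped InnerProductSpace

/-! ### Words of a given length and summability -/

section Words

variable {d : ℕ}

/-- The words of length `m`. -/
def words (d : ℕ) : ℕ → Finset (Word d)
  | 0 => {1}
  | m + 1 => (Finset.univ ×ˢ words d m).image fun p => FreeMonoid.of p.1 * p.2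

theorem sum_words_zero {M : Type*} [AddCommMonoid M] (f : Word d → M) :
    ∑ α ∈ words d 0, f α = f 1 := Finset.sum_singleton _ _

theorem sum_words_succ {M : Type*} [AddCommMonoid M] (f : Word d → M) (m : ℕ) :
    ∑ α ∈ words d (m + 1), f α = ∑ k, ∑ α ∈ words d m, f (FreeMonoid.of k * α) := by
  rw [words, Finset.sum_image, Finset.sum_product]
  rintro ⟨j, β⟩ _ ⟨k, γ⟩ _ h
  obtain ⟨h1, h2⟩ := NCSeries.of_mul_inj.1 h
  exact Prod.ext h1 h2

theorem mem_words {m : ℕ} {α : Word d} : α ∈ words d m ↔ α.length = m := by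
  induction m generalizing α with
  | zero => rw [words, Finset.mem_singleton, FreeMonoid.length_eq_zero]
  | succ m ih =>
    rw [words, Finset.mem_image]
    constructor
    · rintro ⟨⟨k, β⟩, hp, rfl⟩
      rw [Finset.mem_product] at hp
      rw [FreeMonoid.length_mul, FreeMonoid.length_of, ih.1 hp.2, add_comm]
    · intro h
      induction α using FreeMonoid.casesOn with
      | one => simp at h
      | of_mul k β =>
        rw [FreeMonoid.length_mul, FreeMonoid.length_of, add_comm, Nat.add_right_cancel_iff] at h
        exact ⟨(k, β), Finset.mem_product.2 ⟨Finset.mem_univ _, ih.2 h⟩, rfl⟩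

/-- The words of length less than `N`. -/
def wordsLT (d N : ℕ) : Finset (Word d) := (Finset.range N).biUnion (words d)

theorem mem_wordsLT {N : ℕ} {α : Word d} : α ∈ wordsLT d N ↔ α.length < N := by
  simp [wordsLT, mem_words]

theorem sum_wordsLT {M : Type*} [AddCommMonoid M] (f : Word d → M) (N : ℕ) :
    ∑ α ∈ wordsLT d N, f α = ∑ m ∈ Finset.range N, ∑ α ∈ words d m, f α := by
  rw [wordsLT, Finset.sum_biUnion]
  intro i _ j _ hij
  refine Finset.disjoint_left.2 fun α hi hj => hij ?_
  rw [mem_words] at hi hj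
  rw [← hi, hj]

theorem exists_subset_wordsLT (s : Finset (Word d)) : ∃ N, s ⊆ wordsLT d N := by
  refine ⟨s.sup FreeMonoid.length + 1, fun α hα => ?_⟩
  rw [mem_wordsLT]
  exact Nat.lt_succ_of_le (Finset.le_sup (f := FreeMonoid.length) hα)

theorem tendsto_wordsLT : Filter.Tendsto (wordsLT d) Filter.atTop Filter.atTop := by
  refine Filter.tendsto_atTop_finset_of_monotone (fun M N h α hα => ?_) fun α => ?_
  · rw [mem_wordsLT] at hα ⊢; omega
  · exact ⟨α.length + 1, by rw [mem_wordsLT]; omega⟩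

/-- Powers of `ZL^*` group words by length, while evaluations sum over all words unordered; this
reconciles the two sums. -/
theorem hasSum_words_unique {M : Type*} [AddCommMonoid M] [TopologicalSpace M] [T2Space M]
    {f : Word d → M} {a b : M} (h : HasSum f a)
    (h' : HasSum (fun m => ∑ α ∈ words d m, f α) b) : a = b := by
  refine tendsto_nhds_unique (h.comp tendsto_wordsLT) ?_
  simpa only [Function.comp_def, sum_wordsLT] using h'.tendsto_sum_nat

theorem summable_of_level_le {f : Word d → ℝ} (hf : ∀ α, 0 ≤ f α) {C r : ℝ} (hC : 0 ≤ C)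
    (hr : 0 ≤ r) (hr1 : r < 1) (h : ∀ m, ∑ α ∈ words d m, f α ≤ C * r ^ m) : Summable f := by
  refine summable_of_sum_le (c := C * (1 - r)⁻¹) hf fun s => ?_
  obtain ⟨N, hN⟩ := exists_subset_wordsLT s
  calc ∑ α ∈ s, f α ≤ ∑ α ∈ wordsLT d N, f α :=
        Finset.sum_le_sum_of_subset_of_nonneg hN fun α _ _ => hf α
    _ ≤ ∑ m ∈ Finset.range N, C * r ^ m := by
        rw [sum_wordsLT]; exact Finset.sum_le_sum fun m _ => h m
    _ ≤ C * (1 - r)⁻¹ := by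
        rw [← Finset.mul_sum]
        refine mul_le_mul_of_nonneg_left ?_ hC
        rw [← tsum_geometric_of_lt_one hr hr1]
        exact (summable_geometric_of_lt_one hr hr1).sum_le_tsum _ fun _ _ => pow_nonneg hr _

/-- The square sums of the coefficients of `x` over words of a given length are at most `C²`. -/
def LevelBounded (x : NCSeries d) (C : ℝ) : Prop :=
  0 ≤ C ∧ ∀ m, ∑ α ∈ words d m, ‖x α‖ ^ 2 ≤ C ^ 2

theorem sum_mul_le_of_sq_le {ι : Type*} {s : Finset ι} {f g : ι → ℝ} {a b : ℝ} (ha : 0 ≤ a)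
    (hb : 0 ≤ b) (hf : ∑ i ∈ s, f i ^ 2 ≤ a ^ 2) (hg : ∑ i ∈ s, g i ^ 2 ≤ b ^ 2) :
    ∑ i ∈ s, f i * g i ≤ a * b := by
  refine (Real.sum_mul_le_sqrt_mul_sqrt s f g).trans ?_
  exact mul_le_mul (Real.sqrt_le_iff.2 ⟨ha, hf⟩) (Real.sqrt_le_iff.2 ⟨hb, hg⟩)
    (Real.sqrt_nonneg _) ha

end Words

/-! ### Evaluation of series at points of the ball -/

namespace NCBall

variable {d n : ℕ}

@[simp] theorem monomial_one (Z : NCBall d n) : Z.monomial 1 = 1 := map_one _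

theorem monomial_mul (Z : NCBall d n) (α β : Word d) :
    Z.monomial (α * β) = Z.monomial α * Z.monomial β := map_mul _ _ _

@[simp] theorem monomial_of (Z : NCBall d n) (k : Fin d) :
    Z.monomial (FreeMonoid.of k) = Z.1 k := FreeMonoid.lift_eval_of _ _

open scoped Matrix.Norms.L2Operator in
-- The row and its adjoint have equal norm, and the adjoint applied to the conjugate of `y` lists
-- the conjugates of the vectors `y Z_k`.
theorem exists_row_bound (Z : NCBall d n) : ∃ r : ℝ, 0 ≤ r ∧ r < 1 ∧ ∀ y : Fin n → ℂ,
    ∑ k, ∑ j, ‖Matrix.vecMul y (Z.1 k) j‖ ^ 2 ≤ r ^ 2 * ∑ i, ‖y i‖ ^ 2 := by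
  refine ⟨_, norm_nonneg _, Z.2, fun y => ?_⟩
  set A : Matrix (Fin n) (Fin d × Fin n) ℂ := Matrix.of fun i p => Z.1 p.1 i p.2 with hA
  have h := Matrix.l2_opNorm_mulVec A.conjTranspose (WithLp.toLp 2 (star y))
  rw [Matrix.l2_opNorm_conjTranspose] at h
  have h2 := pow_le_pow_left₀ (norm_nonneg _) h 2
  rw [mul_pow, EuclideanSpace.norm_sq_eq, EuclideanSpace.norm_sq_eq, Fintype.sum_prod_type] at h2
  have e : ∀ (k : Fin d) (j : Fin n),
      (A.conjTranspose.mulVec (star y)) (k, j) = star (Matrix.vecMul y (Z.1 k) j) := by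
    intro k j
    simp [Matrix.mulVec, Matrix.vecMul, dotProduct, hA, mul_comm]
  simpa [e] using h2

/-- Iterating the row estimate one letter at a time gives geometric decay in `ℓ²` of each level.
Paired by Cauchy–Schwarz with coefficients whose levels are bounded in `ℓ²`, it gives absolute
convergence, however many words a level has. -/
theorem exists_monomial_bound (Z : NCBall d n) : ∃ r : ℝ, 0 ≤ r ∧ r < 1 ∧ ∀ (m : ℕ) (i j : Fin n),
    ∑ α ∈ words d m, ‖Z.monomial α i j‖ ^ 2 ≤ (r ^ m) ^ 2 := by
  obtain ⟨r, h0, h1, hr⟩ := Z.exists_row_bound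
  refine ⟨r, h0, h1, ?_⟩
  have key : ∀ (m : ℕ) (y : Fin n → ℂ),
      ∑ α ∈ words d m, ∑ j, ‖Matrix.vecMul y (Z.monomial α) j‖ ^ 2
        ≤ (r ^ m) ^ 2 * ∑ i, ‖y i‖ ^ 2 := by
    intro m
    induction m with
    | zero => intro y; simp [sum_words_zero]
    | succ m ih =>
      intro y
      rw [sum_words_succ]
      simp only [monomial_mul, monomial_of, ← Matrix.vecMul_vecMul]
      calc _ ≤ ∑ k, (r ^ m) ^ 2 * ∑ i, ‖Matrix.vecMul y (Z.1 k) i‖ ^ 2 :=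
            Finset.sum_le_sum fun k _ => ih _
        _ ≤ (r ^ m) ^ 2 * (r ^ 2 * ∑ i, ‖y i‖ ^ 2) := by
            rw [← Finset.mul_sum]
            exact mul_le_mul_of_nonneg_left (hr y) (by positivity)
        _ = _ := by ring
  intro m i j
  have h := key m (Pi.single i 1)
  have e : ∑ l, ‖(Pi.single i 1 : Fin n → ℂ) l‖ ^ 2 = 1 := by
    rw [Finset.sum_eq_single i] <;> simp +contextual
  rw [e, mul_one] at h
  refine le_trans (Finset.sum_le_sum fun α _ => ?_) h
  rw [Matrix.single_one_vecMul]
  exact Finset.single_le_sum (f := fun l => ‖Z.monomial α i l‖ ^ 2) (fun l _ => by positivity)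
    (Finset.mem_univ j)

end NCBall

/-- The series `∑ x_α Z^α` converges to `F`. -/
def HasEval {d n : ℕ} (x : NCSeries d) (Z : NCBall d n) (F : Matrix (Fin n) (Fin n) ℂ) : Prop :=
  HasSum (fun α : Word d => x α • Z.monomial α) F

section Eval

variable {d n : ℕ} {Z : NCBall d n} {x y : NCSeries d} {F G : Matrix (Fin n) (Fin n) ℂ}

theorem matrix_summable {ι : Type*} {f : ι → Matrix (Fin n) (Fin n) ℂ}
    (h : ∀ i j, Summable fun a => f a i j) : Summable f :=
  Pi.summable.2 fun i => Pi.summable.2 fun j => h i j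

theorem LevelBounded.summable_norm {C : ℝ} (hx : LevelBounded x C) (Z : NCBall d n)
    (i j : Fin n) : Summable fun α => ‖x α‖ * ‖Z.monomial α i j‖ := by
  obtain ⟨r, h0, h1, hr⟩ := Z.exists_monomial_bound
  exact summable_of_level_le (fun α => by positivity) hx.1 h0 h1 fun m =>
    sum_mul_le_of_sq_le hx.1 (pow_nonneg h0 m) (hx.2 m) (hr m i j)

theorem LevelBounded.exists_hasEval {C : ℝ} (hx : LevelBounded x C) (Z : NCBall d n) :
    ∃ F, HasEval x Z F := by
  have : Summable fun α : Word d => x α • Z.monomial α := by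
    refine matrix_summable fun i j => Summable.of_norm ?_
    simpa using hx.summable_norm Z i j
  exact ⟨_, this.hasSum⟩

theorem HasEval.unique (hF : HasEval x Z F) (hG : HasEval x Z G) : F = G :=
  HasSum.unique hF hG

theorem HasEval.add (hF : HasEval x Z F) (hG : HasEval y Z G) : HasEval (x + y) Z (F + G) := by
  simpa [HasEval, add_smul] using HasSum.add hF hG

theorem HasEval.sub (hF : HasEval x Z F) (hG : HasEval y Z G) : HasEval (x - y) Z (F - G) := by
  simpa [HasEval, sub_smul] using HasSum.sub hF hG

theorem HasEval.smul (c : ℂ) (hF : HasEval x Z F) : HasEval (c • x) Z (c • F) := by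
  simpa [HasEval, smul_smul] using HasSum.const_smul c hF

theorem hasEval_one : HasEval (1 : NCSeries d) Z 1 := by
  have := hasSum_single (f := fun α : Word d => (1 : NCSeries d) α • Z.monomial α) 1
    fun α h => by simp [NCSeries.one_apply, h]
  simpa [HasEval] using this

/-- The absolutely convergent double sum is regrouped along the fibres of concatenation; the fibre
over `α` is `splits α`. -/
theorem hasSum_series_mul {R : Type*} [NormedRing R] [NormedAlgebra ℂ R] [CompleteSpace R]
    (φ : Word d →* R) {a b : R} (hx : Summable fun α => ‖x α • φ α‖)
    (hy : Summable fun α => ‖y α • φ α‖) (ha : HasSum (fun α => x α • φ α) a)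
    (hb : HasSum (fun α => y α • φ α) b) : HasSum (fun α => (x * y) α • φ α) (a * b) := by
  set f : Word d × Word d → R := fun p => (x p.1 • φ p.1) * (y p.2 • φ p.2) with hf
  have hs : Summable f := summable_mul_of_summable_norm (f := fun α => x α • φ α)
    (g := fun α => y α • φ α) hx hy
  have h : HasSum f (a * b) := HasSum.mul (f := fun α => x α • φ α)
    (g := fun α => y α • φ α) ha hb hs
  have h' : HasSum (f ∘ Equiv.sigmaFiberEquiv (fun p : Word d × Word d => p.1 * p.2)) (a * b) :=
    (Equiv.hasSum_iff _).2 h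
  refine h'.sigma fun α => ?_
  have h3 : HasSum (f ∘ ((↑) : NCSeries.splits α → Word d × Word d))
      (∑ p ∈ NCSeries.splits α, f p) := Finset.hasSum _ _
  have e : ∑ p ∈ NCSeries.splits α, f p = (x * y) α • φ α := by
    rw [NCSeries.mul_apply, Finset.sum_smul]
    refine Finset.sum_congr rfl fun p hp => ?_
    rw [← NCSeries.mem_splits.1 hp, map_mul]
    exact smul_mul_smul_comm _ _ _ _
  rw [e] at h3
  exact (Equiv.hasSum_iff (Equiv.subtypeEquivRight
    (fun p => (NCSeries.mem_splits (α := α) (p := p)).symm))).2 h3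

open scoped Matrix.Norms.L2Operator in
theorem HasEval.mul (hF : HasEval x Z F) (hG : HasEval y Z G) : HasEval (x * y) Z (F * G) :=
  hasSum_series_mul (FreeMonoid.lift Z.1) (summable_norm_iff.2 (HasSum.summable hF))
    (summable_norm_iff.2 (HasSum.summable hG)) hF hG

theorem HasEval.zero_point (x : NCSeries d) (n : ℕ) :
    HasEval x (NCBall.zero d n) (x 1 • 1) := by
  have := hasSum_single (f := fun α : Word d => x α • (NCBall.zero d n).monomial α) 1 fun α h => by
    induction α using FreeMonoid.casesOn with
    | one => exact absurd rfl h
    | of_mul k β =>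
      rw [NCBall.monomial_mul, NCBall.monomial_of]
      simp [NCBall.zero]
  simpa [HasEval] using this

end Eval

/-! ### A series is determined by its values -/

section Unique

variable {d : ℕ}

/-- The nilpotent matrices that trace the letters of a word `α` along the standard basis. -/
def chainMatrix (α : Word d) (k : Fin d) :
    Matrix (Fin (α.length + 1)) (Fin (α.length + 1)) ℂ :=
  Matrix.of fun i j => if (j : ℕ) = i + 1 ∧ α.toList[(i : ℕ)]? = some k then 1 else 0

/-- Row `i` stands for the state in which the first `i` letters of `α` have been read. Reaching the
last state from `i` means reading exactly the remaining suffix, so the entry `(0, last)` singles out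
`γ = α`. -/
theorem lift_chainMatrix (α γ : Word d) (i : Fin (α.length + 1)) :
    FreeMonoid.lift (chainMatrix α) γ i (Fin.last _) =
      if γ.toList = α.toList.drop i then 1 else 0 := by
  induction γ using FreeMonoid.inductionOn' generalizing i with
  | one =>
    rw [map_one, Matrix.one_apply, FreeMonoid.toList_one]
    refine if_congr ?_ rfl rfl
    rw [eq_comm (a := []), List.drop_eq_nil_iff, Fin.ext_iff]
    have := i.2
    simp only [Fin.val_last, FreeMonoid.length] at this ⊢
    omega
  | of_mul k γ ih =>
    rw [map_mul, FreeMonoid.lift_eval_of, Matrix.mul_apply]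
    simp only [ih, FreeMonoid.toList_of_mul]
    by_cases hi : (i : ℕ) < α.length
    · rw [Finset.sum_eq_single (⟨i + 1, by omega⟩ : Fin (α.length + 1))]
      · have hi' : (i : ℕ) < α.toList.length := hi
        rw [List.drop_eq_getElem_cons hi']
        simp only [chainMatrix, Matrix.of_apply, true_and, List.cons.injEq,
          List.getElem?_eq_getElem hi', Option.some.injEq]
        by_cases h1 : α.toList[(i : ℕ)] = k
        · simp [h1]
        · simp [h1, Ne.symm h1]
      · intro j _ hj
        have : (j : ℕ) ≠ i + 1 := fun h => hj (Fin.ext h)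
        simp [chainMatrix, this]
      · simp
    · have hi' : α.toList.length ≤ (i : ℕ) := not_lt.1 hi
      rw [List.drop_eq_nil_iff.2 hi']
      refine (Finset.sum_eq_zero fun j _ => ?_).trans (if_neg (List.cons_ne_nil _ _)).symm
      have : (j : ℕ) ≠ i + 1 := fun h => by
        have := j.2
        have : α.length ≤ (i : ℕ) := hi'
        omega
      simp [chainMatrix, this]

theorem lift_smul {n : ℕ} (r : ℂ) (N : Fin d → Matrix (Fin n) (Fin n) ℂ) (γ : Word d) :
    FreeMonoid.lift (fun k => r • N k) γ = r ^ γ.length • FreeMonoid.lift N γ := by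
  induction γ using FreeMonoid.inductionOn' with
  | one => simp
  | of_mul k γ ih =>
    rw [map_mul, map_mul, ih, FreeMonoid.lift_eval_of, FreeMonoid.lift_eval_of,
      smul_mul_smul_comm, FreeMonoid.length_mul, FreeMonoid.length_of, pow_add, pow_one]

open scoped Matrix.Norms.L2Operator in
theorem exists_smul_ball {n : ℕ} (N : Fin d → Matrix (Fin n) (Fin n) ℂ) :
    ∃ r : ℂ, r ≠ 0 ∧ ∃ Z : NCBall d n, Z.1 = fun k => r • N k := by
  set A : Matrix (Fin n) (Fin d × Fin n) ℂ := Matrix.of fun i p => N p.1 i p.2 with hA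
  have hpos : 0 < ‖A‖ + 1 := by positivity
  refine ⟨((‖A‖ + 1)⁻¹ : ℝ), by exact_mod_cast (inv_pos.2 hpos).ne', ⟨fun k => _, ?_⟩, rfl⟩
  have e : (Matrix.of fun (i : Fin n) (p : Fin d × Fin n) =>
      ((((‖A‖ + 1)⁻¹ : ℝ) : ℂ) • N p.1) i p.2) = (((‖A‖ + 1)⁻¹ : ℝ) : ℂ) • A := by
    ext i p; simp [hA]
  rw [e, norm_smul, Complex.norm_real, Real.norm_of_nonneg (inv_nonneg.2 hpos.le),
    inv_mul_lt_iff₀ hpos]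
  linarith

/-- Scaled into the ball by a non-zero `r`, the chain matrices of `α` turn the corner entry of the
value into `r ^ |α|` times the coefficient at `α`. -/
theorem series_ext {x y : NCSeries d}
    (h : ∀ (n : ℕ) (Z : NCBall d n), ∃ F, HasEval x Z F ∧ HasEval y Z F) : x = y := by
  ext α
  obtain ⟨r, hr, Z, hZ⟩ := exists_smul_ball (chainMatrix α)
  obtain ⟨F, hx, hy⟩ := h _ Z
  have key : ∀ w : NCSeries d, HasEval w Z F → w α * r ^ α.length = F 0 (Fin.last _) := by
    intro w hw
    have h1 := Pi.hasSum.1 (Pi.hasSum.1 hw 0) (Fin.last _)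
    refine HasSum.unique ?_ h1
    have e : ∀ γ : Word d, (w γ • Z.monomial γ) 0 (Fin.last _) =
        if γ = α then w α * r ^ α.length else 0 := by
      intro γ
      rw [NCBall.monomial, hZ, lift_smul, Matrix.smul_apply, Matrix.smul_apply, lift_chainMatrix]
      by_cases hγ : γ = α
      · subst hγ; simp
      · have : γ.toList ≠ α.toList := hγ
        simp [hγ, this]
    have h2 := hasSum_single (f := fun γ : Word d => (w γ • Z.monomial γ) 0 (Fin.last _)) α
      fun γ hγ => by rw [e, if_neg hγ]
    rwa [e, if_pos rfl] at h2
  exact mul_right_cancel₀ (pow_ne_zero _ hr) ((key x hx).trans (key y hy).symm)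

end Unique
end FreeClark
end

/-! ### Operators on the Fock space and the structure of the operator system. -/

noncomputable section
namespace FreeClark
open scoped InnerProductSpace

/-! ### Vectors of the Fock space as series -/

section Fock

variable {d : ℕ}

/-- The coefficients of a vector of the Fock space. -/
def ser : Fock d →L[ℂ] NCSeries d where
  toFun f := fun α => f α
  map_add' _ _ := rfl
  map_smul' _ _ := rfl
  cont := NCSeries.continuous_of_apply fun α =>
    (lp.evalCLM ℂ (fun _ : Word d => ℂ) 2 α).continuous

theorem ser_apply (f : Fock d) (α : Word d) : ser f α = f α := rfl

theorem ser_injective : Function.Injective (ser : Fock d → NCSeries d) := fun _ _ h =>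
  lp.ext h

theorem ser_basisVec (α : Word d) : ser (basisVec α) = NCSeries.mono α := by
  ext β
  rw [ser_apply, basisVec, lp.single_apply, NCSeries.mono_apply]
  by_cases h : β = α
  · subst h; simp
  · simp [h]

theorem ser_vacuum : ser (vacuum d) = 1 := ser_basisVec 1

theorem inner_basisVec (α : Word d) (f : Fock d) : ⟪basisVec α, f⟫_ℂ = f α := by
  rw [basisVec, lp.inner_single_left]; simp

theorem inner_basisVec_right (α : Word d) (f : Fock d) : ⟪f, basisVec α⟫_ℂ = star (f α) := by
  rw [← inner_conj_symm, inner_basisVec]; rfl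

theorem norm_basisVec (α : Word d) : ‖(basisVec α : Fock d)‖ = 1 := (basisVec_orthonormal d).1 α

theorem hasSum_basisVec (f : Fock d) : HasSum (fun α => f α • basisVec α) f := by
  have h := lp.hasSum_single (p := 2) (by simp) f
  refine h.congr_fun ?_
  intro α
  rw [basisVec, ← lp.single_smul, smul_eq_mul, mul_one]

theorem clm_ext_basisVec {E : Type*} [AddCommGroup E] [Module ℂ E] [TopologicalSpace E] [T2Space E]
    {X Y : Fock d →L[ℂ] E} (h : ∀ α, X (basisVec α) = Y (basisVec α)) : X = Y := by
  ext f
  have hX := (hasSum_basisVec f).mapL X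
  have hY := (hasSum_basisVec f).mapL Y
  simp only [map_smul, h] at hX hY
  exact hX.unique hY

/-- Left multiplication of formal series as a continuous linear map. -/
def mulLeftL (x : NCSeries d) : NCSeries d →L[ℂ] NCSeries d where
  toLinearMap := LinearMap.mulLeft ℂ x
  cont := continuous_const.mul continuous_id

/-- Right multiplication of formal series as a continuous linear map. -/
def mulRightL (x : NCSeries d) : NCSeries d →L[ℂ] NCSeries d where
  toLinearMap := LinearMap.mulRight ℂ x
  cont := continuous_id.mul continuous_const

/-- Formal multiplication is continuous for coefficientwise convergence, so checking basis vectors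
is enough. -/
theorem ser_eq_mul_left {X : Fock d →L[ℂ] Fock d} {x : NCSeries d}
    (h : ∀ α, ser (X (basisVec α)) = x * NCSeries.mono α) (f : Fock d) :
    ser (X f) = x * ser f := by
  have : ser.comp X = (mulLeftL x).comp ser := clm_ext_basisVec fun α => by
    rw [ContinuousLinearMap.comp_apply, h, ContinuousLinearMap.comp_apply, ser_basisVec]; rfl
  exact congrArg (fun Y : Fock d →L[ℂ] NCSeries d => Y f) this

theorem ser_eq_mul_right {X : Fock d →L[ℂ] Fock d} {x : NCSeries d}
    (h : ∀ α, ser (X (basisVec α)) = NCSeries.mono α * x) (f : Fock d) :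
    ser (X f) = ser f * x := by
  have : ser.comp X = (mulRightL x).comp ser := clm_ext_basisVec fun α => by
    rw [ContinuousLinearMap.comp_apply, h, ContinuousLinearMap.comp_apply, ser_basisVec]; rfl
  exact congrArg (fun Y : Fock d →L[ℂ] NCSeries d => Y f) this

theorem leftShift_basisVec (k : Fin d) (α : Word d) :
    leftShift k (basisVec α) = basisVec (FreeMonoid.of k * α) :=
  wordIsometry_basisVec _ (fun _ _ h => mul_left_cancel h) _

theorem ser_leftShift (k : Fin d) (f : Fock d) :
    ser (leftShift k f) = NCSeries.mono (FreeMonoid.of k) * ser f :=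
  ser_eq_mul_left (fun α => by
    rw [leftShift_basisVec, ser_basisVec, NCSeries.mono_mul_mono]) f

/-- The isometry `e_β ↦ e_{βα}`. -/
def rightMonomial (α : Word d) : Fock d →L[ℂ] Fock d :=
  (wordIsometry (fun β => β * α) (fun _ _ h => mul_right_cancel h)).toContinuousLinearMap

theorem rightMonomial_basisVec (α β : Word d) :
    rightMonomial α (basisVec β) = basisVec (β * α) :=
  wordIsometry_basisVec _ (fun _ _ h => mul_right_cancel h) _

theorem ser_rightMonomial (α : Word d) (f : Fock d) :
    ser (rightMonomial α f) = ser f * NCSeries.mono α :=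
  ser_eq_mul_right (fun β => by
    rw [rightMonomial_basisVec, ser_basisVec, NCSeries.mono_mul_mono]) f

theorem rightMonomial_one (f : Fock d) : rightMonomial 1 f = f := by
  apply ser_injective
  rw [ser_rightMonomial, NCSeries.mono_one, mul_one]

theorem rightMonomial_mul (α β : Word d) (f : Fock d) :
    rightMonomial (α * β) f = rightMonomial β (rightMonomial α f) := by
  apply ser_injective
  simp only [ser_rightMonomial, mul_assoc, NCSeries.mono_mul_mono]

theorem leftMonomial_of_mul (k : Fin d) (α : Word d) :
    leftMonomial (FreeMonoid.of k * α) = leftShift k * leftMonomial α := by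
  rw [leftMonomial, map_mul, FreeMonoid.lift_eval_of]; rfl

theorem leftMonomial_one : leftMonomial (1 : Word d) = 1 := map_one _

theorem ser_leftMonomial (α : Word d) (f : Fock d) :
    ser (leftMonomial α f) = NCSeries.mono α * ser f := by
  induction α using FreeMonoid.inductionOn' with
  | one => rw [leftMonomial_one, NCSeries.mono_one, one_mul]; rfl
  | of_mul k α ih =>
    rw [leftMonomial_of_mul, mul_apply_eq_comp, ser_leftShift, ih, ← mul_assoc,
      NCSeries.mono_mul_mono]

theorem leftMonomial_vacuum (α : Word d) : leftMonomial α (vacuum d) = basisVec α := by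
  apply ser_injective
  rw [ser_leftMonomial, ser_vacuum, mul_one, ser_basisVec]

theorem leftShift_adjoint_apply (k : Fin d) (f : Fock d) (α : Word d) :
    (leftShift k).adjoint f α = f (FreeMonoid.of k * α) := by
  rw [← inner_basisVec, ContinuousLinearMap.adjoint_inner_right, leftShift_basisVec,
    inner_basisVec]

theorem transposeUnitary_basisVec (α : Word d) :
    transposeUnitary d (basisVec α) = basisVec α.reverse :=
  wordIsometry_basisVec _
    (fun _ _ h => by simpa using congrArg FreeMonoid.reverse h) _

theorem ser_transposeUnitary (f : Fock d) :
    ser (transposeUnitary d f) = NCSeries.rev (ser f) := by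
  let Y : NCSeries d →L[ℂ] NCSeries d :=
    { toFun := NCSeries.rev
      map_add' := fun _ _ => rfl
      map_smul' := fun _ _ => rfl
      cont := NCSeries.continuous_of_apply fun α => NCSeries.continuous_apply _ }
  have : ser.comp (transposeUnitary d) = Y.comp ser := clm_ext_basisVec fun α => by
    rw [ContinuousLinearMap.comp_apply, ContinuousLinearMap.comp_apply, ser_basisVec]
    rw [transposeUnitary_basisVec, ser_basisVec]
    ext β
    change _ = NCSeries.mono α β.reverse
    rw [NCSeries.mono_apply, NCSeries.mono_apply]
    refine if_congr ⟨fun h => ?_, fun h => ?_⟩ rfl rfl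
    · rw [h, FreeMonoid.reverse_reverse]
    · rw [← h, FreeMonoid.reverse_reverse]
  exact congrArg (fun Y : Fock d →L[ℂ] NCSeries d => Y f) this

theorem norm_transposeUnitary (f : Fock d) : ‖transposeUnitary d f‖ = ‖f‖ :=
  LinearIsometry.norm_map _ f

theorem transposeUnitary_adjoint_apply (f : Fock d) :
    (transposeUnitary d).adjoint f = transposeUnitary d f := by
  refine lp.ext (funext fun α => ?_)
  rw [← inner_basisVec, ContinuousLinearMap.adjoint_inner_right,
    transposeUnitary_basisVec, inner_basisVec]
  exact (congrFun (ser_transposeUnitary f) α).symm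

theorem norm_sq_eq_tsum (f : Fock d) : HasSum (fun α => ‖f α‖ ^ 2) (‖f‖ ^ 2) := by
  have := lp.hasSum_norm (p := 2) (by simp) f
  simpa using this

theorem levelBounded_ser (f : Fock d) : LevelBounded (ser f) ‖f‖ :=
  ⟨norm_nonneg f, fun m => sum_le_hasSum _ (fun α _ => by positivity) (norm_sq_eq_tsum f)⟩

/-! ### Adjoints of the left creation operators -/

theorem leftShift_adjoint_mul (j k : Fin d) :
    (leftShift j).adjoint * leftShift k = if j = k then (1 : Fock d →L[ℂ] Fock d) else 0 := by
  ext f α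
  rw [mul_apply_eq_comp, leftShift_adjoint_apply]
  have h := congrFun (ser_leftShift k f) (FreeMonoid.of j * α)
  rw [ser_apply] at h
  rw [h]
  split_ifs with hjk
  · subst hjk
    exact NCSeries.mono_mul_apply_mul _ _ _
  · rw [NCSeries.mul_apply]
    refine Finset.sum_eq_zero fun p hp => ?_
    have h1 : p.1 ≠ FreeMonoid.of k := fun h1 => by
      rw [NCSeries.mem_splits, h1] at hp
      exact hjk (NCSeries.of_mul_inj.1 hp).1.symm
    rw [NCSeries.mono_apply, if_neg h1, zero_mul]

/-- The vector `x = ∑ L_k L_k^* f` satisfies `⟨x, f⟩ = ⟨x, x⟩ = S` because the ranges of the `L_k`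
are orthogonal, so `‖x‖² ≤ ‖x‖ ‖f‖`. -/
theorem sum_norm_leftShift_adjoint_le (f : Fock d) :
    ∑ k, ‖(leftShift k).adjoint f‖ ^ 2 ≤ ‖f‖ ^ 2 := by
  set S := ∑ k, ‖(leftShift k).adjoint f‖ ^ 2 with hS
  set x : Fock d := ∑ k, leftShift k ((leftShift k).adjoint f) with hx
  have h1 : ⟪x, f⟫_ℂ = (S : ℂ) := by
    rw [hx, sum_inner, hS]
    push_cast
    refine Finset.sum_congr rfl fun k _ => ?_
    rw [← ContinuousLinearMap.adjoint_inner_right, inner_self_eq_norm_sq_to_K]; rfl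
  have h2 : ⟪x, x⟫_ℂ = (S : ℂ) := by
    have h3 : ∀ k, (leftShift k).adjoint x = (leftShift k).adjoint f := by
      intro k
      rw [hx, map_sum, Finset.sum_eq_single k]
      · rw [← mul_apply_eq_comp, leftShift_adjoint_mul, if_pos rfl]; rfl
      · intro j _ hj
        rw [← mul_apply_eq_comp, leftShift_adjoint_mul, if_neg hj.symm]; rfl
      · simp
    have h4 : ∀ y, ⟪x, y⟫_ℂ =
        ∑ k, ⟪(leftShift k).adjoint f, (leftShift k).adjoint y⟫_ℂ := by
      intro y
      simp only [hx, sum_inner, ContinuousLinearMap.adjoint_inner_right]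
    rw [← h1, h4, h4]
    simp only [h3]
  have h3 : ‖x‖ ^ 2 = S := by
    rw [inner_self_eq_norm_sq_to_K] at h2
    exact Complex.ofReal_injective (by rw [← h2]; push_cast; rfl)
  have h4 : S ≤ ‖x‖ * ‖f‖ := by
    have := norm_inner_le_norm (𝕜 := ℂ) x f
    rw [h1, Complex.norm_real] at this
    exact (le_abs_self S).trans this
  have h5 : ‖x‖ ≤ ‖f‖ := by
    by_contra! h
    nlinarith [norm_nonneg f]
  rw [← h3]
  exact pow_le_pow_left₀ (norm_nonneg _) h5 2

/-- `(L^*)^α = L_{i₁}^* ⋯ L_{iₙ}^*` for the word `α = i₁ ⋯ iₙ`. -/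
def lstar (α : Word d) : Fock d →L[ℂ] Fock d :=
  FreeMonoid.lift (fun k => (leftShift k).adjoint) α

theorem lstar_one : lstar (1 : Word d) = 1 := map_one _

theorem lstar_mul (α β : Word d) : lstar (α * β) = lstar α * lstar β := map_mul _ _ _

theorem lstar_of (k : Fin d) : lstar (FreeMonoid.of k) = (leftShift k).adjoint :=
  FreeMonoid.lift_eval_of _ _

theorem star_leftMonomial (α : Word d) : star (leftMonomial α) = lstar α.reverse := by
  induction α using FreeMonoid.inductionOn' with
  | one => rw [NCSeries.reverse_one, lstar_one, leftMonomial_one, star_one]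
  | of_mul k α ih =>
    rw [leftMonomial_of_mul, star_mul, ih, FreeMonoid.reverse_mul, lstar_mul,
      FreeMonoid.reverse_of, lstar_of]; rfl

theorem star_lstar (α : Word d) : star (lstar α) = leftMonomial α.reverse := by
  rw [← star_star (leftMonomial _), star_leftMonomial, FreeMonoid.reverse_reverse]

theorem sum_norm_lstar_le (m : ℕ) (f : Fock d) :
    ∑ α ∈ words d m, ‖lstar α f‖ ^ 2 ≤ ‖f‖ ^ 2 := by
  induction m with
  | zero => simp [sum_words_zero, lstar_one]
  | succ m ih =>
    rw [sum_words_succ, Finset.sum_comm]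
    refine le_trans (Finset.sum_le_sum fun α _ => ?_) ih
    simp only [lstar_mul, lstar_of, mul_apply_eq_comp]
    exact sum_norm_leftShift_adjoint_le _

/-- Cauchy–Schwarz against the column contraction `f ↦ ((L^*)^α f)`. The bound is the `ℓ²` norm of
the coefficients, which the triangle inequality would not give. -/
theorem norm_sum_lstar_le {m : ℕ} {c : Word d → ℂ} {C : ℝ} (hC : 0 ≤ C)
    (h : ∑ α ∈ words d m, ‖c α‖ ^ 2 ≤ C ^ 2) : ‖∑ α ∈ words d m, c α • lstar α‖ ≤ C := by
  refine ContinuousLinearMap.opNorm_le_bound _ hC fun f => ?_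
  rw [sum_apply]
  refine (norm_sum_le _ _).trans ?_
  simp only [smul_apply, norm_smul]
  exact sum_mul_le_of_sq_le hC (norm_nonneg _) h (sum_norm_lstar_le m f)

/-! ### The operator `Z L^*` -/

variable {n : ℕ}

theorem zLstar_pow_apply (Z : NCBall d n) (m : ℕ) (i j : Fin n) :
    (zLstar Z ^ m) i j = ∑ α ∈ words d m, Z.monomial α i j • lstar α := by
  induction m generalizing i j with
  | zero =>
    rw [sum_words_zero, pow_zero, NCBall.monomial_one, lstar_one, Matrix.one_apply,
      Matrix.one_apply, ite_smul, one_smul, zero_smul]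
  | succ m ih =>
    have e : ∀ l, zLstar Z i l = ∑ k, Z.1 k i l • (leftShift k).adjoint := fun _ => rfl
    rw [pow_succ', Matrix.mul_apply, sum_words_succ]
    simp only [ih, e, NCBall.monomial_mul, NCBall.monomial_of, lstar_mul,
      lstar_of, Matrix.mul_apply, Finset.sum_smul, Finset.sum_mul, Finset.mul_sum,
      smul_mul_smul_comm]
    exact (Finset.sum_comm.trans (Finset.sum_congr rfl fun α _ => Finset.sum_comm)).trans
      Finset.sum_comm

theorem summable_zLstar_pow (Z : NCBall d n) : Summable fun m => zLstar Z ^ m := by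
  obtain ⟨r, h0, h1, hr⟩ := Z.exists_monomial_bound
  suffices h : ∀ i j, Summable fun m => (zLstar Z ^ m) i j from
    Pi.summable (f := fun m => zLstar Z ^ m).2 fun i =>
      Pi.summable (f := fun m => (zLstar Z ^ m) i).2 fun j => h i j
  intro i j
  refine Summable.of_norm_bounded (g := fun m => r ^ m) (summable_geometric_of_lt_one h0 h1)
    fun m => ?_
  rw [zLstar_pow_apply]
  exact norm_sum_lstar_le (pow_nonneg h0 m) (hr m i j)

theorem isUnit_one_sub_zLstar (Z : NCBall d n) : IsUnit (1 - zLstar Z) :=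
  ⟨⟨_, _, (summable_zLstar_pow Z).one_sub_mul_tsum_pow,
    (summable_zLstar_pow Z).tsum_pow_mul_one_sub⟩, rfl⟩

theorem cayley_zLstar (Z : NCBall d n) :
    (1 + zLstar Z) * Ring.inverse (1 - zLstar Z) = (2 : ℂ) • (∑' m, zLstar Z ^ m) - 1 := by
  set S := ∑' m, zLstar Z ^ m with hS
  have h1 : (1 - zLstar Z) * S = 1 := (summable_zLstar_pow Z).one_sub_mul_tsum_pow
  have h2 : Ring.inverse (1 - zLstar Z) = S := by
    have := congrArg (Ring.inverse (1 - zLstar Z) * ·) h1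
    simpa only [← mul_assoc, Ring.inverse_mul_cancel _ (isUnit_one_sub_zLstar Z), one_mul,
      mul_one] using this.symm
  rw [h2, two_smul]
  have h3 : zLstar Z * S = S - 1 := by rw [← h1, sub_mul, one_mul]; abel
  rw [add_mul, one_mul, h3]
  abel

theorem hasSum_zLstar_apply (Z : NCBall d n) (i j : Fin n) :
    HasSum (fun m => ∑ α ∈ words d m, Z.monomial α i j • lstar α) ((∑' m, zLstar Z ^ m) i j) := by
  have h := Pi.hasSum.1 (Pi.hasSum.1 (summable_zLstar_pow Z).hasSum i) j
  simpa only [zLstar_pow_apply] using h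

end Fock

/-! ### The free disk operator system -/

section System

variable {d : ℕ}

theorem word_reverse_induction {p : Word d → Prop} (α : Word d) (one : p 1)
    (mul_of : ∀ α k, p α → p (α * FreeMonoid.of k)) : p α :=
  List.reverseRecOn (motive := p) α one fun α k h => mul_of α k h

theorem isClosed_diskSystem (d : ℕ) : IsClosed (diskSystem d : Set (Fock d →L[ℂ] Fock d)) :=
  Submodule.isClosed_topologicalClosure _

theorem one_mem_diskSystem : (1 : Fock d →L[ℂ] Fock d) ∈ diskSystem d := by
  rw [← leftMonomial_one]; exact leftMonomial_mem 1

theorem mem_diskAlgebraStar {T : Fock d →L[ℂ] Fock d} :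
    T ∈ diskAlgebraStar d ↔ star T ∈ diskAlgebra d := Iff.rfl

theorem mem_diskSystem {T : Fock d →L[ℂ] Fock d} : T ∈ diskSystem d ↔
    T ∈ closure ((diskAlgebra d ⊔ diskAlgebraStar d : Submodule ℂ (Fock d →L[ℂ] Fock d)) :
      Set (Fock d →L[ℂ] Fock d)) := Iff.rfl

theorem star_mem_sup {T : Fock d →L[ℂ] Fock d} (hT : T ∈ diskAlgebra d ⊔ diskAlgebraStar d) :
    star T ∈ diskAlgebra d ⊔ diskAlgebraStar d := by
  obtain ⟨A, hA, B, hB, rfl⟩ := Submodule.mem_sup.1 hT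
  rw [star_add, add_comm]
  refine Submodule.add_mem_sup (mem_diskAlgebraStar.1 hB) (mem_diskAlgebraStar.2 ?_)
  rwa [star_star]

theorem star_mem_diskSystem {T : Fock d →L[ℂ] Fock d} (hT : T ∈ diskSystem d) :
    star T ∈ diskSystem d := by
  rw [mem_diskSystem] at hT ⊢
  exact map_mem_closure continuous_star hT fun S hS => star_mem_sup hS

theorem lstar_mem (α : Word d) : lstar α ∈ diskSystem d := by
  rw [← star_star (lstar α), star_lstar]
  exact star_mem_diskSystem (leftMonomial_mem _)

theorem diskSystem_le {E : Submodule ℂ (Fock d →L[ℂ] Fock d)}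
    (hE : IsClosed (E : Set (Fock d →L[ℂ] Fock d))) (hL : ∀ α, leftMonomial α ∈ E)
    (hstar : ∀ T, star T ∈ diskAlgebra d → star T ∈ E → T ∈ E) : diskSystem d ≤ E := by
  have h1 : diskAlgebra d ≤ E := by
    refine Submodule.topologicalClosure_minimal _ (Submodule.span_le.2 ?_) hE
    rintro _ ⟨α, rfl⟩
    exact hL α
  exact Submodule.topologicalClosure_minimal _
    (sup_le h1 fun T hT => hstar T hT (h1 hT)) hE

/-- The relation `L_k^* L_j = δ_{kj}` cancels adjacent letters in the middle until the product is
zero or one of the words is exhausted. -/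
theorem lstar_mul_star_lstar_mem (α γ : Word d) : lstar α * star (lstar γ) ∈ diskSystem d := by
  induction α using word_reverse_induction generalizing γ with
  | one => rw [lstar_one, one_mul]; exact star_mem_diskSystem (lstar_mem γ)
  | mul_of α k ih =>
    induction γ using word_reverse_induction with
    | one => rw [lstar_one, star_one, mul_one]; exact lstar_mem _
    | mul_of γ j _ =>
      have h : (leftShift k).adjoint * star (leftShift j).adjoint =
          if k = j then (1 : Fock d →L[ℂ] Fock d) else 0 := by
        rw [← leftShift_adjoint_mul, ContinuousLinearMap.star_eq_adjoint,
          ContinuousLinearMap.adjoint_adjoint]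
      rw [lstar_mul, lstar_mul, star_mul, lstar_of, lstar_of, mul_assoc, ← mul_assoc _ _ (star _),
        h]
      split_ifs
      · rw [one_mul]; exact ih γ
      · rw [zero_mul, mul_zero]; exact zero_mem _

/-- The operators `T` with `R_j^* T R_k = δ_{jk} T` for the right creation operators `R_k`. -/
def rightToeplitz (d : ℕ) : Submodule ℂ (Fock d →L[ℂ] Fock d) where
  carrier := {T | ∀ j k : Fin d, star (rightMonomial (FreeMonoid.of j)) * T *
    rightMonomial (FreeMonoid.of k) = if j = k then T else 0}
  zero_mem' := by intro j k; simp
  add_mem' {S T} hS hT := by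
    intro j k
    rw [mul_add, add_mul, hS j k, hT j k]
    split_ifs <;> simp
  smul_mem' c T hT := by
    intro j k
    rw [mul_smul_comm, smul_mul_assoc, hT j k]
    split_ifs <;> simp

theorem star_rightMonomial_mul (j k : Fin d) : star (rightMonomial (FreeMonoid.of j)) *
    rightMonomial (FreeMonoid.of k) = if j = k then (1 : Fock d →L[ℂ] Fock d) else 0 := by
  refine clm_ext_basisVec fun α => lp.ext (funext fun β => ?_)
  rw [ContinuousLinearMap.star_eq_adjoint, ← inner_basisVec, mul_apply_eq_comp,
    ContinuousLinearMap.adjoint_inner_right, rightMonomial_basisVec, rightMonomial_basisVec,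
    orthonormal_iff_ite.1 (basisVec_orthonormal d)]
  by_cases hjk : j = k
  · subst hjk
    rw [if_pos rfl, one_apply_eq_self, ← inner_basisVec,
      orthonormal_iff_ite.1 (basisVec_orthonormal d)]
    simp
  · rw [if_neg hjk, if_neg fun h => hjk (NCSeries.mul_of_inj.1 h).1]
    rfl

theorem leftMonomial_mul_rightMonomial (α β : Word d) :
    leftMonomial α * rightMonomial β = rightMonomial β * leftMonomial α := by
  ext1 f
  apply ser_injective
  simp only [mul_apply_eq_comp, ser_rightMonomial, ser_leftMonomial, mul_assoc]

/-- Left monomials commute with the right isometries, for which `R_j^* R_k = δ_{jk}`; the Toeplitz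
relation passes to adjoints and norm limits. -/
theorem diskSystem_le_rightToeplitz : diskSystem d ≤ rightToeplitz d := by
  refine diskSystem_le ?_ (fun α j k => ?_) fun T _ hT j k => ?_
  · have : (rightToeplitz d : Set (Fock d →L[ℂ] Fock d)) = ⋂ (j : Fin d) (k : Fin d),
        {T | star (rightMonomial (FreeMonoid.of j)) * T * rightMonomial (FreeMonoid.of k) =
          if j = k then T else 0} := by
      ext T; simp [rightToeplitz]
    rw [this]
    refine isClosed_iInter fun j => isClosed_iInter fun k => isClosed_eq (by fun_prop) ?_
    split_ifs <;> fun_prop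
  · rw [mul_assoc, leftMonomial_mul_rightMonomial, ← mul_assoc, star_rightMonomial_mul]
    split_ifs <;> simp
  · have h := congrArg star (hT k j)
    rw [star_mul, star_mul, star_star, star_star, ← mul_assoc] at h
    rw [h]
    by_cases hjk : j = k
    · simp [hjk]
    · simp [hjk, Ne.symm hjk]

end System
end FreeClark
end

/-! ### From positive functionals to Schur class series. -/

noncomputable section
namespace FreeClark
open scoped InnerProductSpace

/-! ### Positive functionals -/

section Positive

variable {d : ℕ}

/-- A linear functional on the free disk system is positive. -/
def IsPos (μ : diskSystem d →ₗ[ℂ] ℂ) : Prop :=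
  ∀ T : diskSystem d, (T : Fock d →L[ℂ] Fock d).IsPositive → 0 ≤ (μ T).re ∧ (μ T).im = 0

/-- The unit of the free disk system. -/
def sysOne (d : ℕ) : diskSystem d := ⟨1, one_mem_diskSystem⟩

/-- The adjoint of an element of the free disk system. -/
def sysStar (T : diskSystem d) : diskSystem d := ⟨star T.1, star_mem_diskSystem T.2⟩

variable {μ : diskSystem d →ₗ[ℂ] ℂ}

/-- Apply `μ` to the positive operators `‖T‖ ± T`, which stay in the system because it contains the
unit. -/
theorem IsPos.bound_selfAdjoint (hμ : IsPos μ) {T : diskSystem d} (hT : IsSelfAdjoint T.1) :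
    |(μ T).re| ≤ ‖T‖ * (μ (sysOne d)).re ∧ (μ T).im = 0 := by
  have h1 := (hμ (sysOne d) ContinuousLinearMap.isPositive_one).2
  have hp : (((‖T‖ : ℂ) • sysOne d - T : diskSystem d) : Fock d →L[ℂ] Fock d).IsPositive := by
    rw [← ContinuousLinearMap.nonneg_iff_isPositive]
    have := hT.le_algebraMap_norm_self
    rw [← sub_nonneg, Algebra.algebraMap_eq_smul_one] at this
    exact this
  have hm : (((‖T‖ : ℂ) • sysOne d + T : diskSystem d) : Fock d →L[ℂ] Fock d).IsPositive := by
    rw [← ContinuousLinearMap.nonneg_iff_isPositive]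
    have := hT.neg_algebraMap_norm_le_self
    rw [neg_le_iff_add_nonneg, add_comm, Algebra.algebraMap_eq_smul_one] at this
    exact this
  obtain ⟨p1, p2⟩ := hμ _ hp
  obtain ⟨m1, -⟩ := hμ _ hm
  simp only [map_sub, map_add, map_smul, smul_eq_mul, Complex.sub_re, Complex.add_re,
    Complex.re_ofReal_mul, Complex.sub_im, Complex.im_ofReal_mul, h1] at p1 p2 m1
  exact ⟨abs_le.2 ⟨by linarith, by linarith⟩, by linarith⟩

theorem IsPos.bound_and_star (hμ : IsPos μ) (T : diskSystem d) :
    ‖μ T‖ ≤ 2 * (μ (sysOne d)).re * ‖T‖ ∧ μ (sysStar T) = star (μ T) := by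
  have h0 := (hμ (sysOne d) ContinuousLinearMap.isPositive_one).1
  obtain ⟨S₁, hS₁⟩ : ∃ S : diskSystem d, S = (1 / 2 : ℂ) • (T + sysStar T) := ⟨_, rfl⟩
  obtain ⟨S₂, hS₂⟩ : ∃ S : diskSystem d, S = (-Complex.I / 2 : ℂ) • (T - sysStar T) := ⟨_, rfl⟩
  have e : T = S₁ + Complex.I • S₂ := by
    rw [hS₁, hS₂, smul_smul, ← mul_div_assoc, mul_neg, Complex.I_mul_I, neg_neg]
    module
  have e' : sysStar T = S₁ - Complex.I • S₂ := by
    rw [hS₁, hS₂, smul_smul, ← mul_div_assoc, mul_neg, Complex.I_mul_I, neg_neg]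
    module
  have a₁ : IsSelfAdjoint S₁.1 := by
    rw [hS₁]
    change star ((1 / 2 : ℂ) • (T.1 + star T.1)) = (1 / 2 : ℂ) • (T.1 + star T.1)
    rw [star_smul, star_add, star_star, add_comm (star T.1)]
    simp
  have a₂ : IsSelfAdjoint S₂.1 := by
    rw [hS₂]
    change star ((-Complex.I / 2 : ℂ) • (T.1 - star T.1)) = (-Complex.I / 2 : ℂ) • (T.1 - star T.1)
    rw [star_smul, star_sub, star_star, ← neg_sub T.1, smul_neg, ← neg_smul]
    simp [neg_div]
  have n₁ : ‖S₁‖ ≤ ‖T‖ := by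
    have h : ‖T.1 + star T.1‖ ≤ ‖T.1‖ + ‖T.1‖ :=
      (norm_add_le T.1 (star T.1)).trans_eq (congrArg (‖T.1‖ + ·) (norm_star T.1))
    rw [hS₁]
    change ‖(1 / 2 : ℂ) • (T.1 + star T.1)‖ ≤ ‖T.1‖
    rw [norm_smul]
    have h' : ‖(1 / 2 : ℂ)‖ = 1 / 2 := by simp
    rw [h']
    linarith
  have n₂ : ‖S₂‖ ≤ ‖T‖ := by
    have h : ‖T.1 - star T.1‖ ≤ ‖T.1‖ + ‖T.1‖ :=
      (norm_sub_le T.1 (star T.1)).trans_eq (congrArg (‖T.1‖ + ·) (norm_star T.1))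
    rw [hS₂]
    change ‖(-Complex.I / 2 : ℂ) • (T.1 - star T.1)‖ ≤ ‖T.1‖
    rw [norm_smul]
    have h' : ‖(-Complex.I / 2 : ℂ)‖ = 1 / 2 := by simp
    rw [h']
    linarith
  obtain ⟨b₁, i₁⟩ := hμ.bound_selfAdjoint a₁
  obtain ⟨b₂, i₂⟩ := hμ.bound_selfAdjoint a₂
  have r₁ : μ S₁ = ((μ S₁).re : ℂ) := Complex.ext rfl (by simpa using i₁)
  have r₂ : μ S₂ = ((μ S₂).re : ℂ) := Complex.ext rfl (by simpa using i₂)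
  constructor
  · rw [congrArg μ e, map_add, map_smul, smul_eq_mul]
    refine (norm_add_le _ _).trans ?_
    rw [norm_mul, Complex.norm_I, one_mul, r₁, r₂, Complex.norm_real, Complex.norm_real,
      Real.norm_eq_abs, Real.norm_eq_abs]
    have := mul_le_mul_of_nonneg_right n₁ h0
    have := mul_le_mul_of_nonneg_right n₂ h0
    linarith
  · rw [e', congrArg μ e, map_sub, map_add, map_smul, smul_eq_mul, r₁, r₂]
    simp [sub_eq_add_neg]

theorem IsPos.continuous (hμ : IsPos μ) : Continuous μ :=
  AddMonoidHomClass.continuous_of_bound μ _ fun T => (hμ.bound_and_star T).1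

theorem IsPos.selfAdjoint (hμ : IsPos μ) (S T : diskSystem d)
    (h : (S : Fock d →L[ℂ] Fock d) = star (T : Fock d →L[ℂ] Fock d)) : μ S = star (μ T) := by
  have : S = sysStar T := Subtype.ext h
  rw [this]
  exact (hμ.bound_and_star T).2

/-- The locus of agreement is a closed subspace containing every `L^α`, and self-adjointness of both
functionals carries agreement from `T^*` to `T`. -/
theorem functional_ext {ν : diskSystem d →ₗ[ℂ] ℂ} (hμ : Continuous μ) (hν : Continuous ν)
    (sμ : ∀ T, μ (sysStar T) = star (μ T)) (sν : ∀ T, ν (sysStar T) = star (ν T))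
    (h : ∀ α : Word d, μ ⟨leftMonomial α, leftMonomial_mem α⟩ =
      ν ⟨leftMonomial α, leftMonomial_mem α⟩) : μ = ν := by
  set E : Submodule ℂ (Fock d →L[ℂ] Fock d) :=
    (LinearMap.eqLocus μ ν).map (diskSystem d).subtype with hE
  have hmem : ∀ T : diskSystem d, T.1 ∈ E ↔ μ T = ν T := by
    intro T
    rw [hE, Submodule.mem_map]
    constructor
    · rintro ⟨S, hS, h⟩
      have : S = T := Subtype.ext h
      rw [← this]
      exact hS
    · intro h
      exact ⟨T, h, rfl⟩
  have hle : E ≤ diskSystem d := by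
    rintro _ ⟨S, -, rfl⟩
    exact S.2
  have hcl : IsClosed (E : Set (Fock d →L[ℂ] Fock d)) := by
    rw [hE, Submodule.map_coe]
    exact (isClosed_diskSystem d).isClosedEmbedding_subtypeVal.isClosedMap _
      (isClosed_eq hμ hν)
  have hsub : diskSystem d ≤ E := by
    refine diskSystem_le hcl (fun α => (hmem ⟨_, leftMonomial_mem α⟩).2 (h α)) fun T _ hT => ?_
    have hT' : T ∈ diskSystem d := by
      rw [← star_star T]
      exact star_mem_diskSystem (hle hT)
    refine (hmem ⟨T, hT'⟩).2 ?_
    have := (hmem (sysStar ⟨T, hT'⟩)).1 hT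
    rw [sμ, sν] at this
    exact star_injective this
  ext T
  exact (hmem T).1 (hsub T.2)

/-! ### The Herglotz series of a positive functional -/

/-- The moments `μ((L^*)^α)` of a functional. -/
def moments (μ : diskSystem d →ₗ[ℂ] ℂ) : NCSeries d := fun α => μ ⟨lstar α, lstar_mem α⟩

theorem moments_apply (μ : diskSystem d →ₗ[ℂ] ℂ) (α : Word d) :
    moments μ α = μ ⟨lstar α, lstar_mem α⟩ := rfl

theorem moments_one_im (hμ : IsPos μ) : (moments μ 1).im = 0 := by
  refine (hμ ⟨lstar 1, lstar_mem 1⟩ ?_).2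
  simpa only [lstar_one] using ContinuousLinearMap.isPositive_one

theorem moments_one_re (hμ : IsPos μ) : 0 ≤ (moments μ 1).re := by
  refine (hμ ⟨lstar 1, lstar_mem 1⟩ ?_).1
  simpa only [lstar_one] using ContinuousLinearMap.isPositive_one

/-- Duality: testing `μ` on the level-`m` combination of the `(L^*)^α` with conjugate moments as
coefficients gives `S ≤ C √S`, since that operator has norm at most `√S`. -/
theorem levelBounded_moments (hμ : IsPos μ) : ∃ C, LevelBounded (moments μ) C := by
  refine ⟨2 * (μ (sysOne d)).re, ?_, fun m => ?_⟩
  · have h0 := (hμ (sysOne d) ContinuousLinearMap.isPositive_one).1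
    positivity
  set C := 2 * (μ (sysOne d)).re
  set S := ∑ α ∈ words d m, ‖moments μ α‖ ^ 2 with hS
  have hS0 : 0 ≤ S := Finset.sum_nonneg fun α _ => by positivity
  set T : diskSystem d := ∑ α ∈ words d m, star (moments μ α) •
    (⟨lstar α, lstar_mem α⟩ : diskSystem d) with hT
  have h1 : μ T = (S : ℂ) := by
    rw [hT, map_sum, hS]
    push_cast
    refine Finset.sum_congr rfl fun α _ => ?_
    rw [map_smul, ← moments_apply, smul_eq_mul, Complex.star_def, Complex.conj_mul']
  have h2 : ‖T‖ ≤ √S := by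
    have : (T : Fock d →L[ℂ] Fock d) = ∑ α ∈ words d m, star (moments μ α) • lstar α := by
      rw [hT]; simp
    rw [← Submodule.norm_coe, this]
    refine norm_sum_lstar_le (Real.sqrt_nonneg _) ?_
    rw [Real.sq_sqrt hS0]
    simp [hS]
  have h3 := (hμ.bound_and_star T).1
  rw [h1, Complex.norm_real, Real.norm_of_nonneg hS0] at h3
  have hC : 0 ≤ C := by
    have h0 := (hμ (sysOne d) ContinuousLinearMap.isPositive_one).1
    positivity
  have h4 : S ≤ C * √S := h3.trans (mul_le_mul_of_nonneg_left h2 hC)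
  have h5 : √S ≤ C := by
    by_contra! h
    nlinarith [Real.mul_self_sqrt hS0]
  calc S = √S ^ 2 := (Real.sq_sqrt hS0).symm
    _ ≤ C ^ 2 := pow_le_pow_left₀ (Real.sqrt_nonneg _) h5 2

/-- The series with constant term `μ(1) + i t` and the other coefficients `2 μ((L^*)^α)`. -/
def herglotzSeries (μ : diskSystem d →ₗ[ℂ] ℂ) (t : ℝ) : NCSeries d :=
  (2 : ℂ) • moments μ - (moments μ 1 - t * Complex.I) • (1 : NCSeries d)

theorem herglotzSeries_one (t : ℝ) : herglotzSeries μ t 1 = moments μ 1 + t * Complex.I := by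
  simp only [herglotzSeries, NCSeries.sub_apply, NCSeries.smul_apply, NCSeries.one_apply_one]
  ring

theorem herglotzSeries_of_ne_one (t : ℝ) {α : Word d} (h : α ≠ 1) :
    herglotzSeries μ t α = 2 * moments μ α := by
  simp only [herglotzSeries, NCSeries.sub_apply, NCSeries.smul_apply, NCSeries.one_apply, if_neg h]
  ring

theorem hasEval_herglotzSeries {n : ℕ} {Z : NCBall d n} {F : Matrix (Fin n) (Fin n) ℂ} (t : ℝ)
    (h : HasEval (moments μ) Z F) : HasEval (herglotzSeries μ t) Z
      ((2 : ℂ) • F - (moments μ 1 - t * Complex.I) • (1 : Matrix (Fin n) (Fin n) ℂ)) :=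
  (h.smul 2).sub (hasEval_one.smul _)

theorem rder_mono_mul_of (k j : Fin d) (γ : Word d) :
    NCSeries.rder k (NCSeries.mono (γ * FreeMonoid.of j)) =
      if k = j then NCSeries.mono γ else 0 := by
  ext α
  rw [NCSeries.rder_apply, NCSeries.mono_apply]
  simp only [NCSeries.mul_of_inj]
  by_cases h : k = j
  · simp [h, NCSeries.mono_apply]
  · simp [h]

/-- Stripping the last letters of both words leaves each side unchanged if they agree and gives zero
on each side if they differ. When one word is empty, the identity is the choice of coefficients of
the Herglotz series; `it` cancels against its conjugate. -/
theorem toeplitz_kernel (hμ : IsPos μ) (t : ℝ) (α γ : Word d) :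
    (herglotzSeries μ t * NCSeries.mono γ) α +
      star ((herglotzSeries μ t * NCSeries.mono α) γ) =
    2 * μ ⟨lstar α * star (lstar γ), lstar_mul_star_lstar_mem α γ⟩ := by
  have h1 : star (moments μ 1) = moments μ 1 := Complex.conj_eq_iff_im.2 (moments_one_im hμ)
  induction α using word_reverse_induction generalizing γ with
  | one =>
    induction γ using word_reverse_induction with
    | one =>
      rw [NCSeries.mono_one, mul_one, herglotzSeries_one]
      have e : (⟨lstar (1 : Word d) * star (lstar 1), lstar_mul_star_lstar_mem 1 1⟩ :
          diskSystem d) = ⟨lstar 1, lstar_mem 1⟩ := Subtype.ext (by simp [lstar_one])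
      rw [e, ← moments_apply, star_add, h1]
      simp
      ring
    | mul_of γ j _ =>
      have e : (⟨lstar (1 : Word d) * star (lstar (γ * FreeMonoid.of j)),
          lstar_mul_star_lstar_mem 1 _⟩ : diskSystem d) =
          sysStar ⟨lstar (γ * FreeMonoid.of j), lstar_mem _⟩ :=
        Subtype.ext (by simp [lstar_one, sysStar])
      rw [e, (hμ.bound_and_star _).2, NCSeries.mul_apply_one, NCSeries.mono_apply,
        if_neg (NCSeries.mul_of_ne_one j γ).symm, mul_zero, zero_add, NCSeries.mono_one, mul_one,
        herglotzSeries_of_ne_one t (NCSeries.mul_of_ne_one j γ), ← moments_apply, star_mul']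
      simp
  | mul_of α k ih =>
    induction γ using word_reverse_induction with
    | one =>
      have e : (⟨lstar (α * FreeMonoid.of k) * star (lstar 1),
          lstar_mul_star_lstar_mem _ 1⟩ : diskSystem d) =
          ⟨lstar (α * FreeMonoid.of k), lstar_mem _⟩ :=
        Subtype.ext (by simp [lstar_one])
      rw [e, NCSeries.mul_apply_one, NCSeries.mono_apply,
        if_neg (NCSeries.mul_of_ne_one k α).symm, mul_zero, star_zero, add_zero,
        NCSeries.mono_one, mul_one,
        herglotzSeries_of_ne_one t (NCSeries.mul_of_ne_one k α), ← moments_apply]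
    | mul_of γ j _ =>
      rw [NCSeries.mul_apply_mul_of, NCSeries.mul_apply_mul_of, NCSeries.mono_apply,
        NCSeries.mono_apply, if_neg (NCSeries.mul_of_ne_one k α).symm,
        if_neg (NCSeries.mul_of_ne_one j γ).symm, mul_zero, mul_zero, zero_add, zero_add,
        rder_mono_mul_of, rder_mono_mul_of]
      have h : (leftShift k).adjoint * star (leftShift j).adjoint =
          if k = j then (1 : Fock d →L[ℂ] Fock d) else 0 := by
        rw [← leftShift_adjoint_mul, ContinuousLinearMap.star_eq_adjoint,
          ContinuousLinearMap.adjoint_adjoint]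
      have e : lstar (α * FreeMonoid.of k) * star (lstar (γ * FreeMonoid.of j)) =
          if k = j then lstar α * star (lstar γ) else 0 := by
        rw [lstar_mul, lstar_mul, star_mul, lstar_of, lstar_of, mul_assoc,
          ← mul_assoc _ _ (star _), h]
        split_ifs <;> simp
      by_cases hkj : k = j
      · have e' : (⟨lstar (α * FreeMonoid.of k) * star (lstar (γ * FreeMonoid.of j)),
            lstar_mul_star_lstar_mem _ _⟩ : diskSystem d) =
            ⟨lstar α * star (lstar γ), lstar_mul_star_lstar_mem α γ⟩ :=
          Subtype.ext (e.trans (if_pos hkj))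
        rw [e', if_pos hkj, if_pos hkj.symm, ih]
      · have e' : (⟨lstar (α * FreeMonoid.of k) * star (lstar (γ * FreeMonoid.of j)),
            lstar_mul_star_lstar_mem _ _⟩ : diskSystem d) = 0 :=
          Subtype.ext (e.trans (if_neg hkj))
        rw [e', if_neg hkj, if_neg (Ne.symm hkj), map_zero]
        simp

/-- Twice the real part of the form is `2 μ(P^* P)` for `P = ∑ c_γ ((L^*)^γ)^*`, and `P^* P` lies in
the system. -/
theorem toeplitz_form_nonneg (hμ : IsPos μ) (t : ℝ) (s : Finset (Word d)) (c : Word d → ℂ) :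
    0 ≤ (∑ α ∈ s, star (c α) *
      ∑ γ ∈ s, c γ * (herglotzSeries μ t * NCSeries.mono γ) α).re := by
  set q : Word d → Word d → ℂ := fun α γ => (herglotzSeries μ t * NCSeries.mono γ) α with hq
  set X := ∑ α ∈ s, star (c α) * ∑ γ ∈ s, c γ * q α γ with hX
  change 0 ≤ X.re
  set P : Fock d →L[ℂ] Fock d := ∑ γ ∈ s, c γ • star (lstar γ) with hP
  have e1 : star P * P = ∑ α ∈ s, ∑ γ ∈ s, (star (c α) * c γ) • (lstar α * star (lstar γ)) := by
    rw [hP, star_sum, Finset.sum_mul_sum]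
    refine Finset.sum_congr rfl fun α _ => Finset.sum_congr rfl fun γ _ => ?_
    rw [star_smul, star_star, smul_mul_smul_comm]
  set T : diskSystem d := ∑ α ∈ s, ∑ γ ∈ s, (star (c α) * c γ) •
    (⟨lstar α * star (lstar γ), lstar_mul_star_lstar_mem α γ⟩ : diskSystem d) with hT
  have e2 : T.1 = star P * P := by rw [e1, hT]; simp
  have hpos : 0 ≤ (μ T).re := by
    refine (hμ T ?_).1
    rw [e2, ← ContinuousLinearMap.nonneg_iff_isPositive]
    exact star_mul_self_nonneg P
  have e3 : X + star X = 2 * μ T := by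
    have h1 : X = ∑ α ∈ s, ∑ γ ∈ s, star (c α) * c γ * q α γ := by
      simp only [hX, Finset.mul_sum, mul_assoc]
    have h2 : star X = ∑ α ∈ s, ∑ γ ∈ s, star (c α) * c γ * star (q γ α) := by
      rw [h1, star_sum, Finset.sum_comm]
      refine Finset.sum_congr rfl fun α _ => ?_
      rw [star_sum]
      refine Finset.sum_congr rfl fun γ _ => ?_
      rw [star_mul', star_mul', star_star]
      ring
    rw [h2, h1, ← Finset.sum_add_distrib, hT, map_sum, Finset.mul_sum]
    refine Finset.sum_congr rfl fun α _ => ?_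
    rw [← Finset.sum_add_distrib, map_sum, Finset.mul_sum]
    refine Finset.sum_congr rfl fun γ _ => ?_
    rw [← mul_add, toeplitz_kernel hμ, map_smul, smul_eq_mul]
    ring
  have e4 := congrArg Complex.re e3
  simp only [Complex.add_re, Complex.star_def, Complex.conj_re, Complex.mul_re, Complex.re_ofNat,
    Complex.im_ofNat, zero_mul, sub_zero] at e4
  linarith

end Positive

/-! ### The Schur class in terms of series -/

section Schur

variable {d : ℕ}

/-- Left multiplication by the series `b` is a contraction of the Fock space. -/
def IsSchurSeries (b : NCSeries d) : Prop :=
  ∀ f : Fock d, ∃ g : Fock d, ser g = b * ser f ∧ ‖g‖ ≤ ‖f‖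

/-- Only truncated inequalities are required, for arbitrary formal `f`; they also give square
summability of `b * f`. -/
theorem isSchurSeries_of_sum_le {b : NCSeries d} (h : ∀ (f : NCSeries d) (N : ℕ),
    ∑ α ∈ wordsLT d N, ‖(b * f) α‖ ^ 2 ≤ ∑ α ∈ wordsLT d N, ‖f α‖ ^ 2) : IsSchurSeries b := by
  intro f
  have h1 : ∀ s : Finset (Word d), ∑ α ∈ s, ‖(b * ser f) α‖ ^ 2 ≤ ‖f‖ ^ 2 := by
    intro s
    obtain ⟨N, hN⟩ := exists_subset_wordsLT s
    calc _ ≤ ∑ α ∈ wordsLT d N, ‖(b * ser f) α‖ ^ 2 :=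
          Finset.sum_le_sum_of_subset_of_nonneg hN fun α _ _ => by positivity
      _ ≤ _ := h _ N
      _ ≤ ‖f‖ ^ 2 := sum_le_hasSum _ (fun α _ => by positivity) (norm_sq_eq_tsum f)
  have hmem : Memℓp (E := fun _ : Word d => ℂ) (b * ser f) 2 := by
    refine memℓp_gen' (C := ‖f‖ ^ 2) fun s => ?_
    simpa using h1 s
  refine ⟨⟨b * ser f, hmem⟩, rfl, ?_⟩
  refine lp.norm_le_of_forall_sum_le (by simp) (norm_nonneg _) fun s => ?_
  simpa using h1 s

theorem IsSchurSeries.exists_hasEval {b : NCSeries d} (hb : IsSchurSeries b) {n : ℕ}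
    (Z : NCBall d n) : ∃ F, HasEval b Z F := by
  obtain ⟨g, hg, -⟩ := hb (vacuum d)
  rw [ser_vacuum, mul_one] at hg
  rw [← hg]
  exact (levelBounded_ser g).exists_hasEval Z

theorem monomial_intertwines {n m : ℕ} {X : Matrix (Fin n) (Fin m) ℂ} {Z : NCBall d n}
    {W : NCBall d m} (h : ∀ k, Z.1 k * X = X * W.1 k) (α : Word d) :
    Z.monomial α * X = X * W.monomial α := by
  induction α using FreeMonoid.inductionOn' with
  | one => simp
  | of_mul k α ih =>
    rw [NCBall.monomial_mul, NCBall.monomial_mul, Matrix.mul_assoc, ih, ← Matrix.mul_assoc,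
      NCBall.monomial_of, h, Matrix.mul_assoc, NCBall.monomial_of]

/-- The free function with the given values, which are values of a single series. -/
def freeFunctionOfSeries (b : NCSeries d) (v : ∀ n, NCBall d n → Matrix (Fin n) (Fin n) ℂ)
    (h : ∀ n Z, HasEval b Z (v n Z)) : FreeFunction d where
  val := v
  intertwines n m X Z W hX := by
    have h1 : HasSum (fun α => (b α • Z.monomial α) * X) (v n Z * X) :=
      HasSum.map (h n Z) (Matrix.addMonoidHomMulRight X) (continuous_id.matrix_mul continuous_const)
    have h2 : HasSum (fun α => X * (b α • W.monomial α)) (X * v m W) :=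
      HasSum.map (h m W) (Matrix.addMonoidHomMulLeft X) (continuous_const.matrix_mul continuous_id)
    have e : ∀ α, (b α • Z.monomial α) * X = X * (b α • W.monomial α) := fun α => by
      rw [Matrix.smul_mul, Matrix.mul_smul, monomial_intertwines hX]
    simp only [e] at h1
    exact h1.unique h2

theorem IsSchurSeries.mem_schurClass {b : NCSeries d} (hb : IsSchurSeries b) {B : FreeFunction d}
    (hB : ∀ n Z, HasEval b Z (B.val n Z)) : B ∈ schurClass d := by
  intro f
  obtain ⟨g, hg, hn⟩ := hb f
  refine ⟨g, fun n Z => ?_, hn⟩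
  obtain ⟨F, hF⟩ := (levelBounded_ser f).exists_hasEval Z
  refine ⟨F, hF, ?_⟩
  have := (hB n Z).mul hF
  rw [← hg] at this
  exact this

/-- The series is that of `B · 1`. For every `f`, the vector representing `B f` has the same values
as the formal product, hence the same coefficients. -/
theorem exists_schurSeries {B : FreeFunction d} (hB : B ∈ schurClass d) :
    ∃ b : NCSeries d, IsSchurSeries b ∧ ∀ n Z, HasEval b Z (B.val n Z) := by
  obtain ⟨g, hg, -⟩ := hB (vacuum d)
  have hb : ∀ n Z, HasEval (ser g) Z (B.val n Z) := by
    intro n Z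
    obtain ⟨F, h1, h2⟩ := hg n Z
    have h1' : HasEval (ser (vacuum d)) Z F := h1
    rw [ser_vacuum] at h1'
    rw [h1'.unique hasEval_one, mul_one] at h2
    exact h2
  refine ⟨ser g, fun f => ?_, hb⟩
  obtain ⟨k, hk, hn⟩ := hB f
  refine ⟨k, series_ext fun n Z => ?_, hn⟩
  obtain ⟨F, h1, h2⟩ := hk n Z
  exact ⟨_, h2, (hb n Z).mul h1⟩

/-- The vector `b · 1` has norm at most one and inner product one with the vacuum, so equality in
Cauchy–Schwarz forces it to be the vacuum. Thus `b ≠ 1` makes `1 - b` formally invertible. -/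
theorem IsSchurSeries.eq_one {b : NCSeries d} (hb : IsSchurSeries b) (h : b 1 = 1) : b = 1 := by
  obtain ⟨g, hg, hn⟩ := hb (vacuum d)
  rw [ser_vacuum, mul_one] at hg
  have h1 : ⟪g, vacuum d⟫_ℂ = 1 := by
    have : g 1 = 1 := (congrFun hg 1).trans h
    rw [vacuum, inner_basisVec_right, this, star_one]
  have h2 := norm_sub_sq (𝕜 := ℂ) g (vacuum d)
  have h3 : ‖vacuum d‖ = 1 := norm_basisVec 1
  rw [h3] at hn h2
  rw [h1, RCLike.one_re] at h2
  have h4 : ‖g - vacuum d‖ = 0 := by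
    have : ‖g‖ ^ 2 ≤ 1 := pow_le_one₀ (norm_nonneg g) hn
    have : ‖g - vacuum d‖ ^ 2 ≤ 0 := by rw [h2]; linarith
    exact pow_eq_zero_iff two_ne_zero |>.1 (le_antisymm this (sq_nonneg _))
  rw [← hg, sub_eq_zero.1 (norm_eq_zero.1 h4), ser_vacuum]

/-- The Cayley transform `(η - 1)(η + 1)⁻¹` of a series. -/
def cayleyInv (η : NCSeries d) : NCSeries d := (η - 1) * NCSeries.inv (η + 1)

theorem isSchurSeries_cayleyInv {μ : diskSystem d →ₗ[ℂ] ℂ} (hμ : IsPos μ) (t : ℝ) :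
    IsSchurSeries (cayleyInv (herglotzSeries μ t)) := by
  set η := herglotzSeries μ t with hη
  have h1 : (η + 1) 1 ≠ 0 := by
    intro h
    have h0 : herglotzSeries μ t 1 + 1 = 0 := h
    have h2 := congrArg Complex.re h0
    rw [herglotzSeries_one] at h2
    have := moments_one_re hμ
    simp at h2
    linarith
  refine isSchurSeries_of_sum_le fun f N => ?_
  -- With `f = (η + 1) k` and `b f = (η - 1) k`, polarization gives `‖f‖² - ‖b f‖² = 4 Re ⟨k, η k⟩`.
  set k := NCSeries.inv (η + 1) * f with hk
  have hf : f = η * k + k := by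
    have : η * k + k = (η + 1) * k := by rw [add_mul, one_mul]
    rw [this, hk, ← mul_assoc, NCSeries.mul_inv h1, one_mul]
  have hbf : cayleyInv η * f = η * k - k := by
    rw [cayleyInv, mul_assoc, ← hk, sub_mul, one_mul]
  -- Coefficients of `η k` below length `N` use only those of `k` below `N`, so the norm identity
  -- holds exactly after truncation.
  have h2 : ∀ α ∈ wordsLT d N,
      (η * k) α = ∑ γ ∈ wordsLT d N, k γ * (η * NCSeries.mono γ) α := by
    intro α hα
    have e : (η * k) α = (η * ∑ γ ∈ wordsLT d N, k γ • NCSeries.mono γ) α := by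
      refine NCSeries.mul_congr_of_length_le (fun _ _ => rfl) fun β hβ => ?_
      rw [NCSeries.sum_apply, Finset.sum_eq_single β]
      · simp [NCSeries.mono_apply]
      · intro γ _ hγ
        simp [NCSeries.mono_apply, Ne.symm hγ]
      · intro h
        rw [mem_wordsLT] at h hα
        omega
    rw [e, Finset.mul_sum, NCSeries.sum_apply]
    refine Finset.sum_congr rfl fun γ _ => ?_
    rw [mul_smul_comm, NCSeries.smul_apply]
  have h3 := toeplitz_form_nonneg hμ t (wordsLT d N) k
  rw [← hη] at h3
  have h4 : ∑ α ∈ wordsLT d N, ‖f α‖ ^ 2 - ∑ α ∈ wordsLT d N, ‖(cayleyInv η * f) α‖ ^ 2 =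
      4 * (∑ α ∈ wordsLT d N, star (k α) *
        ∑ γ ∈ wordsLT d N, k γ * (η * NCSeries.mono γ) α).re := by
    rw [← Finset.sum_sub_distrib, Complex.re_sum, Finset.mul_sum]
    refine Finset.sum_congr rfl fun α hα => ?_
    rw [← h2 α hα, hbf, congrFun hf α, NCSeries.add_apply, NCSeries.sub_apply, ← Complex.normSq_eq_norm_sq,
      ← Complex.normSq_eq_norm_sq, Complex.normSq_apply, Complex.normSq_apply]
    simp
    ring
  linarith

end Schur
end FreeClark
end

/-! ### From Schur class series to positive functionals. -/

noncomputable section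
namespace FreeClark
open scoped InnerProductSpace

/-! ### Positive Toeplitz operators -/

section Toeplitz

section Hilbert

variable {E : Type*} [NormedAddCommGroup E] [InnerProductSpace ℂ E] [CompleteSpace E]

theorem exists_invertible_sqrt {T : E →L[ℂ] E} (h0 : 0 ≤ T) (hu : IsUnit T) :
    ∃ S Si : E →L[ℂ] E, star S = S ∧ S * S = T ∧ S * Si = 1 ∧ Si * S = 1 := by
  obtain ⟨⟨_, Si, h1, h2⟩, h⟩ := (CFC.isUnit_sqrt_iff T h0).2 hu
  simp only at h
  subst h
  exact ⟨_, Si, (IsSelfAdjoint.of_nonneg (CFC.sqrt_nonneg T)).star_eq,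
    CFC.sqrt_mul_sqrt_self T h0, h1, h2⟩

theorem nonneg_isUnit_add_smul_one {T : E →L[ℂ] E} (h0 : 0 ≤ T) {δ : ℝ} (hδ : 0 < δ) :
    0 ≤ T + (δ : ℂ) • (1 : E →L[ℂ] E) ∧ IsUnit (T + (δ : ℂ) • (1 : E →L[ℂ] E)) := by
  have hs : IsStrictlyPositive ((δ : ℂ) • (1 : E →L[ℂ] E)) := by
    refine IsUnit.isStrictlyPositive ?_ ?_
    · rw [← Algebra.algebraMap_eq_smul_one]
      exact (IsUnit.mk0 (δ : ℂ) (by exact_mod_cast hδ.ne')).map (algebraMap ℂ (E →L[ℂ] E))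
    · have e : (δ : ℂ) • (1 : E →L[ℂ] E) =
          star (((√δ : ℝ) : ℂ) • (1 : E →L[ℂ] E)) * (((√δ : ℝ) : ℂ) • (1 : E →L[ℂ] E)) := by
        rw [star_smul, star_one, smul_mul_smul_comm, one_mul, Complex.star_def,
          Complex.conj_ofReal, ← Complex.ofReal_mul, Real.mul_self_sqrt hδ.le]
      rw [e]
      exact star_mul_self_nonneg _
  have := hs.nonneg_add h0
  exact ⟨this.nonneg, this.isUnit⟩

end Hilbert

variable {d : ℕ} {T : Fock d →L[ℂ] Fock d} {w : Fock d}

theorem rightMonomial_of_apply_one (k : Fin d) (f : Fock d) :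
    rightMonomial (FreeMonoid.of k) f 1 = 0 := by
  have h := congrFun (ser_rightMonomial (FreeMonoid.of k) f) 1
  rw [ser_apply] at h
  rw [h, NCSeries.mul_apply_one, NCSeries.mono_apply, if_neg (FreeMonoid.one_ne_of k), mul_zero]

theorem rightMonomial_of_apply_mul_of (j k : Fin d) (f : Fock d) (α : Word d) :
    rightMonomial (FreeMonoid.of j) f (α * FreeMonoid.of k) = if k = j then f α else 0 := by
  have h := congrFun (ser_rightMonomial (FreeMonoid.of j) f) (α * FreeMonoid.of k)
  rw [ser_apply] at h
  have e : (NCSeries.mono (FreeMonoid.of j) : NCSeries d) = NCSeries.mono (1 * FreeMonoid.of j) := by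
    rw [one_mul]
  rw [h, NCSeries.mul_apply_mul_of, NCSeries.mono_apply, if_neg (FreeMonoid.one_ne_of j), mul_zero,
    zero_add, e, rder_mono_mul_of]
  split_ifs
  · rw [NCSeries.mono_one, mul_one]; rfl
  · rw [mul_zero]; rfl

theorem star_rightMonomial_of_apply (k : Fin d) (f : Fock d) (α : Word d) :
    star (rightMonomial (FreeMonoid.of k)) f α = f (α * FreeMonoid.of k) := by
  rw [ContinuousLinearMap.star_eq_adjoint, ← inner_basisVec,
    ContinuousLinearMap.adjoint_inner_right, rightMonomial_basisVec, inner_basisVec]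

theorem eq_sum_rightMonomial {f : Fock d} (hf : f 1 = 0) :
    f = ∑ k, rightMonomial (FreeMonoid.of k) (star (rightMonomial (FreeMonoid.of k)) f) := by
  apply ser_injective
  rw [map_sum]
  ext α
  rw [NCSeries.sum_apply]
  simp only [ser_apply]
  induction α using word_reverse_induction with
  | one => simp [rightMonomial_of_apply_one, hf]
  | mul_of α k _ =>
    simp [rightMonomial_of_apply_mul_of, star_rightMonomial_of_apply]

theorem inner_rightToeplitz (hT : T ∈ rightToeplitz d) (j k : Fin d) (f g : Fock d) :
    ⟪rightMonomial (FreeMonoid.of j) f, T (rightMonomial (FreeMonoid.of k) g)⟫_ℂ =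
      if j = k then ⟪f, T g⟫_ℂ else 0 := by
  rw [← ContinuousLinearMap.adjoint_inner_right, ← ContinuousLinearMap.star_eq_adjoint,
    ← mul_apply_eq_comp, ← mul_apply_eq_comp, hT j k]
  split_ifs <;> simp

/-- Common last letters are removed by the Toeplitz relation. If just one word runs out, `T w = 1`
is orthogonal to the range of each right shift. -/
theorem inner_toeplitz_orbit (hT : T ∈ rightToeplitz d) (hsa : star T = T) (hw : T w = vacuum d)
    (α β : Word d) : ⟪rightMonomial α w, T (rightMonomial β w)⟫_ℂ =
      if α = β then ⟪w, T w⟫_ℂ else 0 := by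
  induction α using word_reverse_induction generalizing β with
  | one =>
    induction β using word_reverse_induction with
    | one => simp [rightMonomial_one]
    | mul_of β k _ =>
      rw [if_neg (NCSeries.mul_of_ne_one k β).symm, rightMonomial_one, rightMonomial_mul, ← hsa,
        ContinuousLinearMap.star_eq_adjoint, ContinuousLinearMap.adjoint_inner_right, hw,
        vacuum, inner_basisVec, rightMonomial_of_apply_one]
  | mul_of α k ih =>
    induction β using word_reverse_induction with
    | one =>
      rw [if_neg (NCSeries.mul_of_ne_one k α), rightMonomial_one, rightMonomial_mul, hw, vacuum,
        inner_basisVec_right, rightMonomial_of_apply_one, star_zero]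
    | mul_of β j _ =>
      rw [rightMonomial_mul, rightMonomial_mul, inner_rightToeplitz hT, ih]
      simp only [NCSeries.mul_of_inj]
      by_cases hkj : k = j <;> simp [hkj]

/-- The empty word gives a zero vacuum coefficient, so `f = ∑ R_k R_k^* f`. Each `R_k^* f` then
satisfies the same hypothesis, and the coefficients vanish by induction on words. -/
theorem eq_zero_of_inner_toeplitz_orbit (hT : T ∈ rightToeplitz d) (hw : T w = vacuum d)
    {f : Fock d} (hf : ∀ α, ⟪f, T (rightMonomial α w)⟫_ℂ = 0) : f = 0 := by
  refine lp.ext (funext fun γ => ?_)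
  change f γ = 0
  induction γ using word_reverse_induction generalizing f with
  | one =>
    have := hf 1
    rwa [rightMonomial_one, hw, vacuum, inner_basisVec_right, star_eq_zero] at this
  | mul_of γ k ih =>
    have hf1 : f 1 = 0 := by
      have := hf 1
      rwa [rightMonomial_one, hw, vacuum, inner_basisVec_right, star_eq_zero] at this
    rw [← star_rightMonomial_of_apply]
    refine ih fun α => ?_
    have h2 := hf (α * FreeMonoid.of k)
    rw [rightMonomial_mul, eq_sum_rightMonomial hf1, sum_inner] at h2
    simpa [inner_rightToeplitz hT] using h2

/-- If `T` is a positive invertible right Toeplitz operator and `H` is a right multiplier with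
positive real part, then `T H` has positive real part. -/
theorem re_inner_toeplitz_mul_nonneg (hT : T ∈ rightToeplitz d) (h0 : 0 ≤ T) (hu : IsUnit T)
    {H : Fock d →L[ℂ] Fock d} {u : NCSeries d} (hH : ∀ f, ser (H f) = ser f * u)
    (hpos : ∀ f, 0 ≤ (⟪f, H f⟫_ℂ).re) (x : Fock d) : 0 ≤ (⟪x, T (H x)⟫_ℂ).re := by
  have hsa : star T = T := (IsSelfAdjoint.of_nonneg h0).star_eq
  obtain ⟨S, Si, hSsa, hSS, hSSi, hSiS⟩ := exists_invertible_sqrt h0 hu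
  have hinner : ∀ f g, ⟪S f, S g⟫_ℂ = ⟪f, T g⟫_ℂ := by
    intro f g
    rw [← ContinuousLinearMap.adjoint_inner_right, ← ContinuousLinearMap.star_eq_adjoint, hSsa,
      ← mul_apply_eq_comp, hSS]
  obtain ⟨w, hw⟩ : ∃ w, T w = vacuum d := by
    obtain ⟨⟨_, Ti, hTTi, -⟩, rfl⟩ := hu
    exact ⟨Ti (vacuum d), by rw [← mul_apply_eq_comp, hTTi]; rfl⟩
  have hSw : S w ≠ 0 := by
    intro h
    have h2 : T w = 0 := by rw [← hSS, mul_apply_eq_comp, h, map_zero]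
    rw [hw] at h2
    have h3 := norm_basisVec (1 : Word d)
    rw [← vacuum, h2, norm_zero] at h3
    exact zero_ne_one h3
  have hn : (‖S w‖ : ℂ) ≠ 0 := by exact_mod_cast norm_ne_zero_iff.2 hSw
  obtain ⟨w', hw'⟩ : ∃ w' : Fock d, w' = (‖S w‖ : ℂ)⁻¹ • w := ⟨_, rfl⟩
  -- In the inner product `⟨·, T·⟩ = ⟨S·, S·⟩` the translates of `w = T⁻¹ 1` are orthogonal with
  -- equal norms, as in the Szegő construction.
  have hv : Orthonormal ℂ fun α : Word d => S (rightMonomial α w') := by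
    rw [orthonormal_iff_ite]
    intro α β
    rw [hinner, hw', map_smul, map_smul, map_smul, inner_smul_left, inner_smul_right,
      inner_toeplitz_orbit hT hsa hw, ← hinner, inner_self_eq_norm_sq_to_K]
    split_ifs
    · rw [map_inv₀, Complex.conj_ofReal]
      change (‖S w‖ : ℂ)⁻¹ * ((‖S w‖ : ℂ)⁻¹ * (‖S w‖ : ℂ) ^ 2) = 1
      field_simp
    · simp
  obtain ⟨V, hV⟩ : ∃ V : Fock d →ₗᵢ[ℂ] Fock d,
      ∀ α, V (basisVec α) = S (rightMonomial α w') := by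
    refine ⟨hv.orthogonalFamily.linearIsometry, fun α => ?_⟩
    rw [basisVec, OrthogonalFamily.linearIsometry_apply_single]
    simp
  -- `W = S⁻¹ V` satisfies `⟨W f, T W g⟩ = ⟨f, g⟩`. It sends `e_α` to a right translate of `w'`, so
  -- it is left multiplication by `w'` and commutes with the right multiplier `H`.
  obtain ⟨W, hWdef⟩ : ∃ W : Fock d →L[ℂ] Fock d, W = Si * V.toContinuousLinearMap := ⟨_, rfl⟩
  have hSW : ∀ f, S (W f) = V f := by
    intro f
    rw [← mul_apply_eq_comp, hWdef, ← mul_assoc, hSSi, one_mul]; rfl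
  have hWb : ∀ α, W (basisVec α) = rightMonomial α w' := by
    intro α
    rw [hWdef, mul_apply_eq_comp]
    change Si (V (basisVec α)) = _
    rw [hV, ← mul_apply_eq_comp, hSiS]; rfl
  have hWser : ∀ f, ser (W f) = ser w' * ser f :=
    ser_eq_mul_left fun α => by rw [hWb, ser_rightMonomial]
  have hHW : ∀ f, H (W f) = W (H f) := by
    intro f
    apply ser_injective
    rw [hH, hWser, hWser, hH, mul_assoc]
  have hWpos : ∀ f, 0 ≤ (⟪W f, T (H (W f))⟫_ℂ).re := by
    intro f
    rw [hHW, ← hinner, hSW, hSW, V.inner_map_map]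
    exact hpos f
  -- A vector orthogonal to the range is `T f` for some `f`, and then `f` is `T`-orthogonal to every
  -- right translate of `w`.
  have hdense : Dense (LinearMap.range (W : Fock d →ₗ[ℂ] Fock d) : Set (Fock d)) := by
    rw [Submodule.dense_iff_topologicalClosure_eq_top, Submodule.topologicalClosure_eq_top_iff,
      Submodule.eq_bot_iff]
    intro y hy
    obtain ⟨f, rfl⟩ : ∃ f, T f = y := by
      obtain ⟨⟨_, Ti, hTTi, -⟩, rfl⟩ := hu
      exact ⟨Ti y, by rw [← mul_apply_eq_comp, hTTi]; rfl⟩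
    have hf : f = 0 := by
      refine eq_zero_of_inner_toeplitz_orbit hT hw fun α => ?_
      have h2 := (Submodule.mem_orthogonal' _ _).1 hy (W (basisVec α)) ⟨_, rfl⟩
      rw [hWb, hw', map_smul, inner_smul_right, mul_eq_zero,
        or_iff_right (inv_ne_zero hn), ← ContinuousLinearMap.adjoint_inner_right,
        ← ContinuousLinearMap.star_eq_adjoint, hsa] at h2
      exact h2
    rw [hf, map_zero]
  have hcl : IsClosed {x : Fock d | 0 ≤ (⟪x, T (H x)⟫_ℂ).re} :=
    isClosed_le continuous_const (by fun_prop)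
  refine hcl.closure_subset_iff.2 ?_ (hdense x)
  rintro _ ⟨f, rfl⟩
  exact hWpos f

/-- The functional `T ↦ (⟪1, T h⟫ + ⟪h, T 1⟫) / 2` on the free disk system. -/
def vectorFunctional (h : Fock d) : diskSystem d →ₗ[ℂ] ℂ where
  toFun T := (1 / 2 : ℂ) * (⟪vacuum d, T.1 h⟫_ℂ + ⟪h, T.1 (vacuum d)⟫_ℂ)
  map_add' S T := by
    simp only [Submodule.coe_add, add_apply, inner_add_right]
    ring
  map_smul' c T := by
    simp only [Submodule.coe_smul, smul_apply, inner_smul_right, smul_eq_mul, RingHom.id_apply]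
    ring

theorem vectorFunctional_apply (h : Fock d) (T : diskSystem d) : vectorFunctional h T =
    (1 / 2 : ℂ) * (⟪vacuum d, T.1 h⟫_ℂ + ⟪h, T.1 (vacuum d)⟫_ℂ) := rfl

/-- For positive `T` the value is `Re ⟨1, T H 1⟩`. Adding a small multiple of the unit makes `T`
invertible without leaving the Toeplitz operators. -/
theorem isPos_vectorFunctional {H : Fock d →L[ℂ] Fock d} {u : NCSeries d}
    (hH : ∀ f, ser (H f) = ser f * u) (hpos : ∀ f, 0 ≤ (⟪f, H f⟫_ℂ).re) :
    IsPos (vectorFunctional (H (vacuum d))) := by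
  intro T hT
  obtain ⟨T, hmem⟩ := T
  simp only at hT
  have hT0 : 0 ≤ T := ContinuousLinearMap.nonneg_iff_isPositive _ |>.2 hT
  have hsa : star T = T := (IsSelfAdjoint.of_nonneg hT0).star_eq
  set h := H (vacuum d) with hh
  have e : ⟪h, T (vacuum d)⟫_ℂ = star ⟪vacuum d, T h⟫_ℂ := by
    rw [← ContinuousLinearMap.adjoint_inner_left, ← ContinuousLinearMap.star_eq_adjoint, hsa]
    exact (inner_conj_symm _ _).symm
  have e' : vectorFunctional h ⟨T, hmem⟩ = ((⟪vacuum d, T h⟫_ℂ).re : ℂ) := by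
    rw [vectorFunctional_apply]
    simp only [e]
    rw [Complex.star_def, Complex.add_conj]
    push_cast
    ring
  rw [e', Complex.ofReal_re, Complex.ofReal_im]
  have key : 0 ≤ (⟪vacuum d, T h⟫_ℂ).re := by
    refine le_of_forall_pos_lt_add fun ε hε => ?_
    -- The summand `1` keeps `C` positive; with `δ = ε / C` the perturbation contributes less than
    -- `ε`.
    set C := |(⟪vacuum d, h⟫_ℂ).re| + 1 with hC
    have hC0 : 0 < C := by positivity
    set δ : ℝ := ε / C with hδ
    have hδ0 : 0 < δ := div_pos hε hC0
    obtain ⟨p0, pu⟩ := nonneg_isUnit_add_smul_one hT0 hδ0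
    have h1 := re_inner_toeplitz_mul_nonneg (T := T + (δ : ℂ) • 1)
      ((rightToeplitz d).add_mem (diskSystem_le_rightToeplitz hmem)
        ((rightToeplitz d).smul_mem _ (diskSystem_le_rightToeplitz one_mem_diskSystem)))
      p0 pu hH hpos (vacuum d)
    rw [← hh, add_apply, smul_apply, one_apply_eq_self, inner_add_right,
      inner_smul_right, Complex.add_re, Complex.re_ofReal_mul] at h1
    have h2 : δ * (⟪vacuum d, h⟫_ℂ).re < ε := by
      calc δ * (⟪vacuum d, h⟫_ℂ).re ≤ δ * |(⟪vacuum d, h⟫_ℂ).re| :=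
            mul_le_mul_of_nonneg_left (le_abs_self _) hδ0.le
        _ < δ * C := mul_lt_mul_of_pos_left (by rw [hC]; linarith) hδ0
        _ = ε := div_mul_cancel₀ _ hC0.ne'
    linarith
  exact ⟨key, rfl⟩

/-- The second term survives only at the empty word because `L_k^* 1 = 0`. The reversal comes from
`((L^*)^α)^*` and matches the passage from `b` to `rev b`. -/
theorem moments_vectorFunctional (h : Fock d) (α : Word d) : moments (vectorFunctional h) α =
    (1 / 2 : ℂ) * (h α.reverse + if α = 1 then star (h 1) else 0) := by
  rw [moments_apply, vectorFunctional_apply]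
  have e : lstar α = star (leftMonomial α.reverse) := by
    rw [star_leftMonomial, FreeMonoid.reverse_reverse]
  have h1 : ⟪vacuum d, lstar α h⟫_ℂ = h α.reverse := by
    rw [e, ContinuousLinearMap.star_eq_adjoint, ContinuousLinearMap.adjoint_inner_right,
      leftMonomial_vacuum, inner_basisVec]
  have h2 : ⟪h, lstar α (vacuum d)⟫_ℂ = if α = 1 then star (h 1) else 0 := by
    split_ifs with hα
    · rw [hα, lstar_one, one_apply_eq_self, vacuum, inner_basisVec_right]
    · induction α using word_reverse_induction with
      | one => exact absurd rfl hα
      | mul_of α k _ =>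
        have : (leftShift k).adjoint (vacuum d) = 0 := by
          refine lp.ext (funext fun β => ?_)
          rw [leftShift_adjoint_apply, ← ser_apply, ser_vacuum, NCSeries.one_apply_of_mul]
          rfl
        rw [lstar_mul, lstar_of, mul_apply_eq_comp, this, map_zero, inner_zero_right]
  rw [h1, h2]

end Toeplitz

/-! ### Existence of the Clark functional -/

section Existence

variable {d : ℕ} {b : NCSeries d}

/-- Conjugation by `U_†` reverses products. The multiplier is needed on the right so that it
commutes with left multiplication by `w'`. -/
theorem IsSchurSeries.exists_rightMultiplier (hb : IsSchurSeries b) :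
    ∃ A : Fock d →L[ℂ] Fock d, (∀ f, ‖A f‖ ≤ ‖f‖) ∧ ∀ f, ser (A f) = ser f * NCSeries.rev b := by
  choose g hg hn using hb
  let M : Fock d →ₗ[ℂ] Fock d :=
    { toFun := g
      map_add' := fun f f' => ser_injective (by simp only [map_add, hg, mul_add])
      map_smul' := fun c f => ser_injective (by simp [hg]) }
  let M' : Fock d →L[ℂ] Fock d := M.mkContinuous 1 fun f => by rw [one_mul]; exact hn f
  refine ⟨transposeUnitary d * M' * transposeUnitary d, fun f => ?_, fun f => ?_⟩
  · rw [mul_apply_eq_comp, mul_apply_eq_comp, norm_transposeUnitary]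
    refine (hn _).trans_eq (norm_transposeUnitary f)
  · rw [mul_apply_eq_comp, mul_apply_eq_comp, ser_transposeUnitary]
    have : ser (M' (transposeUnitary d f)) = b * NCSeries.rev (ser f) := by
      rw [← ser_transposeUnitary]; exact hg _
    rw [this, NCSeries.rev_mul, NCSeries.rev_rev]

/-- The Cayley transform `(1 + b)(1 - b)⁻¹` of a series. -/
def cayley (b : NCSeries d) : NCSeries d := (1 + b) * NCSeries.inv (1 - b)

theorem cayley_comm (h : (1 - b) 1 ≠ 0) : cayley b = NCSeries.inv (1 - b) * (1 + b) := by
  have e : (1 + b) = (2 : ℂ) • 1 - (1 - b) := by rw [two_smul]; abel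
  rw [cayley, e, sub_mul, mul_sub, NCSeries.mul_inv h, NCSeries.inv_mul h, smul_mul_assoc,
    mul_smul_comm, one_mul, mul_one]

theorem exists_cayley_operator {A : Fock d →L[ℂ] Fock d} {a : NCSeries d} (hA : ∀ f, ‖A f‖ ≤ ‖f‖)
    (ha : ∀ f, ser (A f) = ser f * a) {s : ℝ} (hs0 : 0 ≤ s) (hs1 : s < 1) :
    ∃ H : Fock d →L[ℂ] Fock d, (∀ f, ser (H f) = ser f * cayley ((s : ℂ) • a)) ∧
      ∀ f, 0 ≤ (⟪f, H f⟫_ℂ).re := by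
  have hn : ‖(s : ℂ) • A‖ < 1 := by
    rw [norm_smul, Complex.norm_real, Real.norm_of_nonneg hs0]
    have : ‖A‖ ≤ 1 := A.opNorm_le_bound zero_le_one fun f => by rw [one_mul]; exact hA f
    nlinarith [norm_nonneg A]
  obtain ⟨⟨_, K, hK1, hK2⟩, hU⟩ := isUnit_one_sub_of_norm_lt_one hn
  simp only at hU
  subst hU
  have h1 : ∀ f, ser (K f) * (1 - (s : ℂ) • a) = ser f := by
    intro f
    have := congrArg (fun X : Fock d →L[ℂ] Fock d => ser (X f)) hK1
    simp only [mul_apply_eq_comp, sub_apply, smul_apply, one_apply_eq_self, map_sub, map_smul,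
      ha] at this
    rw [mul_sub, mul_one, mul_smul_comm, this]
  have h2 : (1 - (s : ℂ) • a) 1 ≠ 0 := by
    intro h
    have := congrFun (h1 (vacuum d)) 1
    rw [NCSeries.mul_apply_one, h, mul_zero, ser_vacuum, NCSeries.one_apply_one] at this
    exact zero_ne_one this
  refine ⟨(1 + (s : ℂ) • A) * K, fun f => ?_, fun f => ?_⟩
  · have h3 : ser (K f) = ser f * NCSeries.inv (1 - (s : ℂ) • a) := by
      rw [← h1 f, mul_assoc, NCSeries.mul_inv h2, mul_one]
    rw [mul_apply_eq_comp, add_apply, smul_apply, one_apply_eq_self, map_add, map_smul, ha, h3,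
      cayley_comm h2, mul_add, mul_one, mul_add, mul_smul_comm, mul_smul_comm, mul_assoc]
  -- Writing `f = (1 - sA) k`, the real part of `⟨f, H f⟩` is `‖k‖² - ‖sA k‖²`.
  · obtain ⟨k, rfl⟩ : ∃ k, (1 - (s : ℂ) • A) k = f :=
      ⟨K f, by rw [← mul_apply_eq_comp, hK1]; rfl⟩
    have h3 : ((1 + (s : ℂ) • A) * K) ((1 - (s : ℂ) • A) k) = k + (s : ℂ) • A k := by
      rw [mul_apply_eq_comp, ← mul_apply_eq_comp K, hK2]; rfl
    have h4 : (1 - (s : ℂ) • A) k = k - (s : ℂ) • A k := rfl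
    rw [h3, h4]
    have h5 : ‖(s : ℂ) • A k‖ ≤ ‖k‖ := by
      rw [norm_smul, Complex.norm_real, Real.norm_of_nonneg hs0]
      have := hA k
      nlinarith [norm_nonneg (A k)]
    set y := (s : ℂ) • A k
    have h6 : (⟪y, k⟫_ℂ).re = (⟪k, y⟫_ℂ).re := by
      rw [← inner_conj_symm, Complex.conj_re]
    have h7 : (⟪k, k⟫_ℂ).re = ‖k‖ ^ 2 := inner_self_eq_norm_sq (𝕜 := ℂ) k
    have h8 : (⟪y, y⟫_ℂ).re = ‖y‖ ^ 2 := inner_self_eq_norm_sq (𝕜 := ℂ) y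
    rw [inner_sub_left, inner_add_right, inner_add_right, Complex.sub_re, Complex.add_re,
      Complex.add_re, h6, h7, h8]
    have := pow_le_pow_left₀ (norm_nonneg _) h5 2
    linarith

/-- Convergence of the moment at the empty word bounds `μ n (1)`, hence every sequence `μ n T`. A
free ultrafilter then gives a pointwise limit that is linear and positive. -/
theorem exists_limit_functional {μ : ℕ → diskSystem d →ₗ[ℂ] ℂ} (hμ : ∀ n, IsPos (μ n))
    {m : NCSeries d} (hm : Filter.Tendsto (fun n => moments (μ n)) Filter.atTop (nhds m)) :
    ∃ ν : diskSystem d →ₗ[ℂ] ℂ, IsPos ν ∧ moments ν = m := by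
  have happ : ∀ α, Filter.Tendsto (fun n => moments (μ n) α) Filter.atTop (nhds (m α)) :=
    fun α => ((NCSeries.continuous_apply α).tendsto m).comp hm
  obtain ⟨C, hC⟩ : ∃ C, ∀ n, (μ n (sysOne d)).re ≤ C := by
    have h1 := ((Complex.continuous_re.tendsto _).comp (happ 1)).bddAbove_range
    obtain ⟨C, hC⟩ := h1
    refine ⟨C, fun n => ?_⟩
    have h2 := hC ⟨n, rfl⟩
    have e : (⟨lstar (1 : Word d), lstar_mem 1⟩ : diskSystem d) = sysOne d :=
      Subtype.ext lstar_one
    simpa only [Function.comp_apply, moments_apply, e] using h2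
  let U : Filter ℕ := (Filter.hyperfilter ℕ : Filter ℕ)
  have hU : U ≤ Filter.atTop := Nat.hyperfilter_le_atTop
  have hlim : ∀ T : diskSystem d, ∃ z, Filter.Tendsto (fun n => μ n T) U (nhds z) := by
    intro T
    have hmem : Metric.closedBall (0 : ℂ) (2 * C * ‖T‖) ∈
        ((Filter.hyperfilter ℕ).map fun n => μ n T) := by
      refine Filter.mem_map.2 (Filter.univ_mem' fun n => ?_)
      rw [Set.mem_preimage, mem_closedBall_zero_iff]
      refine ((hμ n).bound_and_star T).1.trans ?_
      gcongr
      exact hC n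
    obtain ⟨z, -, hz⟩ := (isCompact_closedBall _ _).ultrafilter_le_nhds' _ hmem
    exact ⟨z, hz⟩
  choose ν hν using hlim
  refine ⟨linearMapOfTendsto ν μ (l := U) (tendsto_pi_nhds.2 hν), fun T hT => ⟨?_, ?_⟩, ?_⟩
  · exact ge_of_tendsto' ((Complex.continuous_re.tendsto _).comp (hν T)) fun n => (hμ n T hT).1
  · refine tendsto_nhds_unique ((Complex.continuous_im.tendsto _).comp (hν T)) ?_
    refine tendsto_const_nhds.congr fun n => ((hμ n T hT).2).symm
  · ext α
    exact tendsto_nhds_unique (hν ⟨lstar α, lstar_mem α⟩) ((happ α).mono_left hU)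

theorem one_sub_apply_one_ne_zero (hb : IsSchurSeries b) (hb1 : b ≠ 1) : (1 - b) 1 ≠ 0 := by
  intro h
  rw [NCSeries.sub_apply, NCSeries.one_apply_one, sub_eq_zero] at h
  exact hb1 (hb.eq_one h.symm)

theorem rev_cayley (h : (1 - b) 1 ≠ 0) : NCSeries.rev (cayley b) = cayley (NCSeries.rev b) := by
  rw [cayley_comm h, NCSeries.rev_mul, NCSeries.rev_inv h, NCSeries.rev_add, NCSeries.rev_sub,
    NCSeries.rev_one, cayley]

theorem exists_clark_functional (hb : IsSchurSeries b) (hb1 : b ≠ 1) :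
    ∃ μ : diskSystem d →ₗ[ℂ] ℂ, IsPos μ ∧ herglotzSeries μ (cayley b 1).im = cayley b := by
  have hne := one_sub_apply_one_ne_zero hb hb1
  obtain ⟨A, hA, ha⟩ := hb.exists_rightMultiplier
  set a := NCSeries.rev b with ha_def
  have hne' : (1 - a) 1 ≠ 0 := hne
  -- `1 - A` need not be boundedly invertible, hence the radii `s n < 1`; they start at `0`.
  set s : ℕ → ℝ := fun n => 1 - 1 / ((n : ℝ) + 1) with hs
  have hs0 : ∀ n, 0 ≤ s n := fun n => by
    have : 1 / ((n : ℝ) + 1) ≤ 1 := by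
      rw [div_le_one (by positivity)]; linarith [Nat.cast_nonneg (α := ℝ) n]
    simp only [hs]; linarith
  have hs1 : ∀ n, s n < 1 := fun n => by
    have : 0 < 1 / ((n : ℝ) + 1) := by positivity
    simp only [hs]; linarith
  have hslim : Filter.Tendsto s Filter.atTop (nhds 1) := by
    have := (tendsto_const_nhds (x := (1 : ℝ))).sub
      (tendsto_one_div_add_atTop_nhds_zero_nat (𝕜 := ℝ))
    simpa only [sub_zero] using this
  choose H hH hpos using fun n => exists_cayley_operator hA ha (hs0 n) (hs1 n)
  have hlim : Filter.Tendsto (fun n => cayley ((s n : ℂ) • a)) Filter.atTop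
      (nhds (cayley a)) := by
    have h1 : Filter.Tendsto (fun n => (s n : ℂ) • a) Filter.atTop (nhds a) := by
      have := ((Complex.continuous_ofReal.tendsto 1).comp hslim).smul_const a
      simpa using this
    exact (tendsto_const_nhds.add h1).mul
      (NCSeries.tendsto_inv hne' (tendsto_const_nhds.sub h1))
  set μ : ℕ → diskSystem d →ₗ[ℂ] ℂ := fun n => vectorFunctional (H n (vacuum d)) with hμ
  have hμpos : ∀ n, IsPos (μ n) := fun n => isPos_vectorFunctional (hH n) (hpos n)
  -- `J` sends the coefficients of `H 1` to the moments of its vector functional; its continuity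
  -- transfers the limit of the Cayley series to the moments.
  let J : NCSeries d → NCSeries d := fun x α =>
    (1 / 2 : ℂ) * (x α.reverse + if α = 1 then star (x 1) else 0)
  have hJ : Continuous J := by
    refine NCSeries.continuous_of_apply fun α => ?_
    refine continuous_const.mul ((NCSeries.continuous_apply _).add ?_)
    split_ifs
    · exact continuous_star.comp (NCSeries.continuous_apply 1)
    · exact continuous_const
  have hmom : ∀ n, moments (μ n) = J (cayley ((s n : ℂ) • a)) := by
    intro n
    ext α
    have e : ser (H n (vacuum d)) = cayley ((s n : ℂ) • a) := by
      rw [hH, ser_vacuum, one_mul]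
    rw [← e]
    exact moments_vectorFunctional _ _
  have hm : Filter.Tendsto (fun n => moments (μ n)) Filter.atTop (nhds (J (cayley a))) := by
    simp only [hmom]
    exact (hJ.tendsto _).comp hlim
  obtain ⟨ν, hν, hνm⟩ := exists_limit_functional hμpos hm
  refine ⟨ν, hν, ?_⟩
  have hrev : ∀ α, cayley a α.reverse = cayley b α := by
    intro α
    rw [ha_def, ← rev_cayley hne, NCSeries.rev_apply, FreeMonoid.reverse_reverse]
  have hmα : ∀ α, moments ν α =
      (1 / 2 : ℂ) * (cayley b α + if α = 1 then star (cayley b 1) else 0) := by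
    intro α
    rw [hνm, ← hrev α, ← hrev 1]; rfl
  ext α
  by_cases hα : α = 1
  · subst hα
    rw [herglotzSeries_one, hmα, if_pos rfl]
    apply Complex.ext
    · simp; ring
    · simp
  · rw [herglotzSeries_of_ne_one _ hα, hmα, if_neg hα]
    ring

end Existence
end FreeClark
end

/-! ### The Cayley transform, the unbounded operator and the Herglotz formula. -/

noncomputable section
namespace FreeClark
open scoped InnerProductSpace

/-! ### Herglotz functions and series -/

section Herglotz

variable {d n : ℕ}

/-- `(F + 1) / 2` is a left inverse of `1 - B(Z)`, which suffices for square matrices. Invertibility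
therefore follows from convergence of the Herglotz series. -/
theorem herglotz_eq {B : FreeFunction d} {Z : NCBall d n} {F : Matrix (Fin n) (Fin n) ℂ}
    (h : F * (1 - B.val n Z) = 1 + B.val n Z) :
    IsUnit (1 - B.val n Z) ∧ herglotz B n Z = F := by
  have h1 : (((1 / 2 : ℂ) • (F + 1)) * (1 - B.val n Z)) = 1 := by
    rw [smul_mul_assoc, add_mul, h, one_mul]
    have : 1 + B.val n Z + (1 - B.val n Z) = (2 : ℂ) • 1 := by rw [two_smul]; abel
    rw [this, smul_smul]
    norm_num
  have hu : IsUnit (1 - B.val n Z) := IsUnit.of_mul_eq_one_right _ h1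
  refine ⟨hu, ?_⟩
  rw [herglotz, ← h, Matrix.mul_assoc,
    Matrix.mul_nonsing_inv _ ((Matrix.isUnit_iff_isUnit_det _).1 hu), Matrix.mul_one]

theorem val_eq_of_herglotz_eq {B B' : FreeFunction d} {Z : NCBall d n}
    (hu : IsUnit (1 - B.val n Z)) (hu' : IsUnit (1 - B'.val n Z))
    (h : herglotz B n Z = herglotz B' n Z) : B.val n Z = B'.val n Z := by
  have key : ∀ {C : FreeFunction d}, IsUnit (1 - C.val n Z) →
      (herglotz C n Z + 1) * (1 - C.val n Z) = (2 : ℂ) • 1 := by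
    intro C hC
    rw [add_mul, herglotz, Matrix.mul_assoc,
      Matrix.nonsing_inv_mul _ ((Matrix.isUnit_iff_isUnit_det _).1 hC), Matrix.mul_one, one_mul,
      two_smul]
    abel
  have h1 := key hu
  have h2 := key hu'
  have h3 : (1 - B'.val n Z) * ((1 / 2 : ℂ) • (herglotz B' n Z + 1)) = 1 := by
    refine mul_eq_one_comm.1 ?_
    rw [smul_mul_assoc, h2, smul_smul]
    norm_num
  have h4 : ((1 / 2 : ℂ) • (herglotz B' n Z + 1)) * (1 - B.val n Z) = 1 := by
    rw [← h, smul_mul_assoc, h1, smul_smul]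
    norm_num
  have h5 : 1 - B'.val n Z = 1 - B.val n Z := by
    calc 1 - B'.val n Z = (1 - B'.val n Z) *
          (((1 / 2 : ℂ) • (herglotz B' n Z + 1)) * (1 - B.val n Z)) := by rw [h4, mul_one]
      _ = _ := by rw [← mul_assoc, h3, one_mul]
  exact (sub_right_injective h5).symm

theorem exists_hasEval_herglotzSeries {μ : diskSystem d →ₗ[ℂ] ℂ} (hμ : IsPos μ) (t : ℝ)
    (Z : NCBall d n) : ∃ F, HasEval (herglotzSeries μ t) Z F := by
  obtain ⟨C, hC⟩ := levelBounded_moments hμ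
  obtain ⟨F, hF⟩ := hC.exists_hasEval Z
  exact ⟨_, hasEval_herglotzSeries t hF⟩

theorem apply_leftMonomial {μ : diskSystem d →ₗ[ℂ] ℂ} (hμ : IsPos μ) (t : ℝ) (α : Word d) :
    μ ⟨leftMonomial α, leftMonomial_mem α⟩ =
      (1 / 2 : ℂ) * ((if α = 1 then herglotzSeries μ t 1 else 0) +
        star (herglotzSeries μ t α.reverse)) := by
  have h1 : star (moments μ 1) = moments μ 1 := Complex.conj_eq_iff_im.2 (moments_one_im hμ)
  have e : (⟨leftMonomial α, leftMonomial_mem α⟩ : diskSystem d) =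
      sysStar ⟨lstar α.reverse, lstar_mem _⟩ :=
    Subtype.ext ((star_lstar _).trans (by rw [FreeMonoid.reverse_reverse])).symm
  rw [e, (hμ.bound_and_star _).2, ← moments_apply]
  by_cases hα : α = 1
  · subst hα
    rw [if_pos rfl, NCSeries.reverse_one, herglotzSeries_one, star_add, h1]
    simp
    ring
  · rw [if_neg hα, herglotzSeries_of_ne_one t (mt NCSeries.reverse_eq_one.1 hα), star_mul']
    simp

theorem herglotzSeries_injective {μ ν : diskSystem d →ₗ[ℂ] ℂ} (hμ : IsPos μ) (hν : IsPos ν)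
    {s t : ℝ} (h : herglotzSeries μ s = herglotzSeries ν t) : μ = ν ∧ s = t := by
  constructor
  · refine functional_ext hμ.continuous hν.continuous (fun T => (hμ.bound_and_star T).2)
      (fun T => (hν.bound_and_star T).2) fun α => ?_
    rw [apply_leftMonomial hμ s, apply_leftMonomial hν t, h]
  · have h1 := congrArg Complex.im (congrFun h 1)
    rw [herglotzSeries_one, herglotzSeries_one, Complex.add_im, Complex.add_im,
      moments_one_im hμ, moments_one_im hν] at h1
    simpa using h1

theorem herglotzSeries_add (μ : diskSystem d →ₗ[ℂ] ℂ) (s t : ℝ) :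
    herglotzSeries μ (t + s) = herglotzSeries μ t + ((s : ℂ) * Complex.I) • (1 : NCSeries d) := by
  rw [herglotzSeries, herglotzSeries, sub_add, ← sub_smul]
  congr 2
  push_cast
  ring

end Herglotz

/-! ### The operator `H_A(R)` -/

section Operator

variable {d : ℕ} {B : FreeFunction d} {η : NCSeries d}

/-- By uniqueness of coefficients, pointwise multiplication on the ball is formal multiplication;
the transpose moves it to the right. -/
theorem mem_rightHerglotzGraph (hη : ∀ n Z, HasEval η Z (herglotz B n Z)) (f g : Fock d) :
    (f, g) ∈ rightHerglotzGraph B ↔ ser g = ser f * NCSeries.rev η := by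
  have h1 : (f, g) ∈ rightHerglotzGraph B ↔ IsLeftProduct (herglotz B)
      ((transposeUnitary d).adjoint f) ((transposeUnitary d).adjoint g) := Iff.rfl
  rw [h1, transposeUnitary_adjoint_apply, transposeUnitary_adjoint_apply]
  have h2 : IsLeftProduct (herglotz B) (transposeUnitary d f) (transposeUnitary d g) ↔
      ser (transposeUnitary d g) = η * ser (transposeUnitary d f) := by
    constructor
    · intro h
      refine series_ext fun n Z => ?_
      obtain ⟨F, hF, hG⟩ := h n Z
      exact ⟨_, hG, (hη n Z).mul hF⟩
    · intro h n Z
      obtain ⟨F, hF⟩ := (levelBounded_ser (transposeUnitary d f)).exists_hasEval Z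
      have h3 := (hη n Z).mul hF
      rw [← h] at h3
      exact ⟨F, hF, h3⟩
  rw [h2, ser_transposeUnitary, ser_transposeUnitary]
  constructor
  · intro h
    rw [← NCSeries.rev_rev (ser g), h, NCSeries.rev_mul, NCSeries.rev_rev]
  · intro h
    rw [h, NCSeries.rev_mul, NCSeries.rev_rev]

theorem rightHerglotz_graph (hη : ∀ n Z, HasEval η Z (herglotz B n Z)) :
    (rightHerglotz B).graph = rightHerglotzGraph B := by
  refine Submodule.toLinearPMap_graph_eq _ fun x hx h0 => ?_
  obtain ⟨f, g⟩ := x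
  rw [mem_rightHerglotzGraph hη] at hx
  simp only at h0 ⊢
  rw [h0, map_zero, zero_mul] at hx
  exact ser_injective (by rw [hx, map_zero])

theorem ser_rightHerglotz (hη : ∀ n Z, HasEval η Z (herglotz B n Z))
    (x : (rightHerglotz B).domain) : ser (rightHerglotz B x) = ser x.1 * NCSeries.rev η := by
  rw [← mem_rightHerglotzGraph hη, ← rightHerglotz_graph hη]
  exact (rightHerglotz B).mem_graph x

/-- If `y` is orthogonal to the range then `⟨A y, y⟩ = ‖y‖²`, and for a contraction this forces `A y
= y`. -/
theorem dense_range_one_sub {E : Type*} [NormedAddCommGroup E] [InnerProductSpace ℂ E]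
    [CompleteSpace E] {A : E →L[ℂ] E} (hA : ∀ f, ‖A f‖ ≤ ‖f‖) (hinj : ∀ f, A f = f → f = 0) :
    Dense (LinearMap.range ((1 - A : E →L[ℂ] E) : E →ₗ[ℂ] E) : Set E) := by
  rw [Submodule.dense_iff_topologicalClosure_eq_top, Submodule.topologicalClosure_eq_top_iff,
    Submodule.eq_bot_iff]
  intro y hy
  refine hinj y ?_
  have h1 : ⟪A y, y⟫_ℂ = ⟪y, y⟫_ℂ := by
    have h := (Submodule.mem_orthogonal _ _).1 hy ((1 - A) y) ⟨y, rfl⟩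
    rw [sub_apply, inner_sub_left, sub_eq_zero] at h
    exact h.symm
  have h2 := norm_sub_sq (𝕜 := ℂ) (A y) y
  rw [h1, inner_self_eq_norm_sq] at h2
  have h3 := pow_le_pow_left₀ (norm_nonneg _) (hA y) 2
  have h4 : ‖A y - y‖ ^ 2 ≤ 0 := by rw [h2]; linarith
  have h5 : ‖A y - y‖ = 0 :=
    (pow_eq_zero_iff two_ne_zero).1 (le_antisymm h4 (sq_nonneg _))
  exact sub_eq_zero.1 (norm_eq_zero.1 h5)

theorem dense_domain_rightHerglotz {b : NCSeries d} (hb : IsSchurSeries b) (hb1 : b ≠ 1)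
    (hη : ∀ n Z, HasEval (cayley b) Z (herglotz B n Z)) :
    Dense ((rightHerglotz B).domain : Set (Fock d)) := by
  have hne := one_sub_apply_one_ne_zero hb hb1
  have hne' : (1 - NCSeries.rev b) 1 ≠ 0 := hne
  obtain ⟨A, hA, ha⟩ := hb.exists_rightMultiplier
  refine (dense_range_one_sub hA fun f hf => ?_).mono ?_
  · have h1 : ser f * (1 - NCSeries.rev b) = 0 := by
      rw [mul_sub, mul_one, ← ha, hf, sub_self]
    refine ser_injective ?_
    rw [map_zero, ← mul_one (ser f), ← NCSeries.mul_inv hne', ← mul_assoc, h1, zero_mul]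
  · rintro _ ⟨k, rfl⟩
    -- `H_A(R)` maps `(1 - A) k` to `(1 + A) k`, so its domain contains the range of `1 - A`.
    refine LinearPMap.mem_domain_iff.2 ⟨(1 + A) k, ?_⟩
    rw [rightHerglotz_graph hη]
    refine (mem_rightHerglotzGraph hη _ _).2 ?_
    change ser (k + A k) = ser (k - A k) * NCSeries.rev (cayley b)
    have h2 : (1 - NCSeries.rev b) * cayley (NCSeries.rev b) = 1 + NCSeries.rev b := by
      rw [cayley_comm hne', ← mul_assoc, NCSeries.mul_inv hne', one_mul]
    have h3 : ser (k - A k) = ser k * (1 - NCSeries.rev b) := by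
      rw [map_sub, ha, mul_sub, mul_one]
    rw [rev_cayley hne, h3, mul_assoc, h2, map_add, ha, mul_add, mul_one]

/-- A coefficient of `f * u` is a finite combination of coefficients of `f`, hence continuous, and
Riesz applies. For `u = rev η` the vector is `H_A(R)^* e_α`. -/
theorem exists_adjoint_vector (u : NCSeries d) (α : Word d) :
    ∃ z : Fock d, ∀ f, ⟪z, f⟫_ℂ = (ser f * u) α := by
  let ℓ : Fock d →L[ℂ] ℂ :=
    ⟨{ toFun := fun f => (ser f * u) α
       map_add' := fun f g => by rw [map_add, add_mul, NCSeries.add_apply]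
       map_smul' := fun c f => by rw [map_smul, smul_mul_assoc]; rfl },
      (NCSeries.continuous_apply α).comp (ser.continuous.mul continuous_const)⟩
  exact ⟨(InnerProductSpace.toDual ℂ (Fock d)).symm ℓ, fun f =>
    InnerProductSpace.toDual_symm_apply⟩

theorem isClarkFunctional_iff {μ ν : diskSystem d →ₗ[ℂ] ℂ} (hν : IsPos ν) {t : ℝ}
    (hη : ∀ n Z, HasEval (herglotzSeries ν t) Z (herglotz B n Z))
    (hd : Dense ((rightHerglotz B).domain : Set (Fock d))) :
    IsClarkFunctional B μ ↔ μ = ν := by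
  set η := herglotzSeries ν t with hη_def
  choose z hz using exists_adjoint_vector (NCSeries.rev η)
  have hadj : ∀ (α : Word d) (x : (rightHerglotz B).domain),
      ⟪z α, (x : Fock d)⟫_ℂ = ⟪basisVec α, rightHerglotz B x⟫_ℂ := by
    intro α x
    rw [hz, inner_basisVec, ← ser_rightHerglotz hη]; rfl
  have hmem : ∀ α : Word d, basisVec α ∈ (rightHerglotz B).adjoint.domain := fun α =>
    LinearPMap.mem_adjoint_domain_of_exists _ ⟨z α, hadj α⟩
  have hval : ∀ (α : Word d) (y : Fock d) (hy : y = basisVec α)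
      (h : y ∈ (rightHerglotz B).adjoint.domain), (rightHerglotz B).adjoint ⟨y, h⟩ = z α := by
    rintro α _ rfl h
    exact LinearPMap.adjoint_apply_eq hd _ (hadj α)
  have hform : ∀ (α : Word d) (h₁ : vacuum d ∈ (rightHerglotz B).adjoint.domain)
      (h₂ : leftMonomial α (vacuum d) ∈ (rightHerglotz B).adjoint.domain),
      (1 / 2 : ℂ) * (⟪(rightHerglotz B).adjoint ⟨vacuum d, h₁⟩, leftMonomial α (vacuum d)⟫_ℂ
          + ⟪vacuum d, (rightHerglotz B).adjoint ⟨leftMonomial α (vacuum d), h₂⟩⟫_ℂ) =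
      ν ⟨leftMonomial α, leftMonomial_mem α⟩ := by
    intro α h₁ h₂
    rw [hval 1 (vacuum d) rfl, hval α _ (leftMonomial_vacuum α), apply_leftMonomial hν t,
      leftMonomial_vacuum, hz, ← inner_conj_symm (vacuum d), hz, ser_vacuum, one_mul,
      NCSeries.mul_apply_one, ser_basisVec, NCSeries.mono_apply]
    by_cases hα : α = 1
    · rw [if_pos hα, if_pos hα.symm, one_mul]; rfl
    · rw [if_neg hα, if_neg (Ne.symm hα), zero_mul]; rfl
  constructor
  · rintro ⟨hc, hs, hf⟩
    refine functional_ext hc hν.continuous (fun T => hs _ _ rfl)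
      (fun T => (hν.bound_and_star T).2) fun α => ?_
    obtain ⟨h₁, h₂, h⟩ := hf α
    rw [h, hform]
  · rintro rfl
    refine ⟨hν.continuous, hν.selfAdjoint, fun α => ?_⟩
    have h₂ : leftMonomial α (vacuum d) ∈ (rightHerglotz B).adjoint.domain := by
      rw [leftMonomial_vacuum]; exact hmem α
    exact ⟨hmem 1, h₂, (hform α (hmem 1) h₂).symm⟩

theorem CayleySchur.exists_series (B : CayleySchur d) :
    ∃ b : NCSeries d, IsSchurSeries b ∧ b ≠ 1 ∧ ∀ n Z, HasEval b Z (B.1.val n Z) := by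
  obtain ⟨b, hb, hB⟩ := exists_schurSeries B.2.1
  refine ⟨b, hb, ?_, hB⟩
  rintro rfl
  refine B.2.2 (FreeFunction.ext ?_)
  funext n Z
  exact (hB n Z).unique hasEval_one

theorem CayleySchur.exists_functional (B : CayleySchur d) :
    ∃ (μ : PositiveFunctional d),
      (∀ n Z, IsUnit (1 - B.1.val n Z)) ∧
      (rightHerglotz B.1).graph = rightHerglotzGraph B.1 ∧
      Dense ((rightHerglotz B.1).domain : Set (Fock d)) ∧
      (∀ ν, IsClarkFunctional B.1 ν ↔ ν = μ.1) ∧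
      ∀ n Z, HasEval (herglotzSeries μ.1 (herglotz B.1 1 (NCBall.zero d 1) 0 0).im) Z
        (herglotz B.1 n Z) := by
  obtain ⟨b, hb, hb1, hB⟩ := B.exists_series
  obtain ⟨μ, hμ, hμb⟩ := exists_clark_functional hb hb1
  have hne := one_sub_apply_one_ne_zero hb hb1
  have hval : ∀ n Z, IsUnit (1 - B.1.val n Z) ∧ HasEval (cayley b) Z (herglotz B.1 n Z) := by
    intro n Z
    obtain ⟨F, hF⟩ := exists_hasEval_herglotzSeries hμ (cayley b 1).im Z
    rw [hμb] at hF
    have h1 := hF.mul (hasEval_one.sub (hB n Z))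
    have h2 : cayley b * (1 - b) = 1 + b := by
      rw [cayley, mul_assoc, NCSeries.inv_mul hne, mul_one]
    rw [h2] at h1
    obtain ⟨h3, h4⟩ := herglotz_eq (h1.unique (hasEval_one.add (hB n Z)))
    exact ⟨h3, h4.symm ▸ hF⟩
  have hη := fun n Z => (hval n Z).2
  have hd := dense_domain_rightHerglotz hb hb1 hη
  have ht : (herglotz B.1 1 (NCBall.zero d 1) 0 0).im = (cayley b 1).im := by
    rw [(hη 1 _).unique (HasEval.zero_point _ 1)]
    simp
  refine ⟨⟨μ, hμ⟩, fun n Z => (hval n Z).1, rightHerglotz_graph hη, hd, fun ν => ?_, ?_⟩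
  · rw [← hμb] at hη
    exact isClarkFunctional_iff hμ hη hd
  · rw [ht, hμb]
    exact hη

theorem exists_cayleySchur {μ : diskSystem d →ₗ[ℂ] ℂ} (hμ : IsPos μ) (t : ℝ) :
    ∃ B : CayleySchur d, ∀ n Z, HasEval (herglotzSeries μ t) Z (herglotz B.1 n Z) := by
  set η := herglotzSeries μ t with hη
  have h1 : (η + 1) 1 ≠ 0 := by
    intro h
    have h0 : herglotzSeries μ t 1 + 1 = 0 := h
    have h2 := congrArg Complex.re h0
    rw [herglotzSeries_one] at h2
    have := moments_one_re hμ
    simp at h2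
    linarith
  have hb := isSchurSeries_cayleyInv hμ t
  rw [← hη] at hb
  set b := cayleyInv η with hb_def
  have hbη : (η + 1) * b = η - 1 := by
    have e : η - 1 = (η + 1) - (2 : ℂ) • 1 := by rw [two_smul]; abel
    rw [hb_def, cayleyInv, e, sub_mul, NCSeries.mul_inv h1, smul_mul_assoc, one_mul, mul_sub,
      mul_one, mul_smul_comm, NCSeries.mul_inv h1]
  choose v hv using fun (n : ℕ) (Z : NCBall d n) => hb.exists_hasEval Z
  refine ⟨⟨freeFunctionOfSeries b v hv, hb.mem_schurClass hv, fun h => ?_⟩, fun n Z => ?_⟩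
  -- If `b` were `1`, then `(η + 1) b = η - 1` would give `1 = -1` in the constant term.
  · have hb1 : b = 1 := series_ext fun n Z => by
      have h2 : v n Z = 1 := congrFun (congrFun (congrArg FreeFunction.val h) n) Z
      exact ⟨v n Z, hv n Z, h2 ▸ hasEval_one⟩
    rw [hb1, mul_one] at hbη
    have h3 := congrFun hbη 1
    rw [NCSeries.add_apply, NCSeries.sub_apply, NCSeries.one_apply_one] at h3
    have h4 : (1 : ℂ) = -1 := by linear_combination h3
    norm_num at h4
  · obtain ⟨F, hF⟩ := exists_hasEval_herglotzSeries hμ t Z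
    have h2 := (hF.add hasEval_one).mul (hv n Z)
    rw [← hη, hbη] at h2
    have h3 := h2.unique (hF.sub hasEval_one)
    have h4 : F * (1 - v n Z) = 1 + v n Z := by
      rw [add_mul, one_mul] at h3
      rw [mul_sub, mul_one, eq_sub_of_add_eq h3]
      abel
    have h5 := (herglotz_eq (B := freeFunctionOfSeries b v hv) h4).2
    rw [h5]
    exact hF

end Operator

/-! ### The Herglotz formula -/

section Formula

variable {d n : ℕ}

theorem tsum_zLstar_pow_mem (Z : NCBall d n) (i j : Fin n) :
    (∑' m, zLstar Z ^ m) i j ∈ diskSystem d := by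
  refine (isClosed_diskSystem d).mem_of_tendsto (hasSum_zLstar_apply Z i j)
    (Filter.Eventually.of_forall fun s => ?_)
  exact Submodule.sum_mem _ fun m _ => Submodule.sum_mem _ fun α _ =>
    Submodule.smul_mem _ _ (lstar_mem α)

/-- Continuity lets `μ` pass through the norm-convergent sum over levels, and the result is compared
with the sum over words. -/
theorem apply_tsum_zLstar_pow {μ : diskSystem d →ₗ[ℂ] ℂ} (hμ : IsPos μ) (Z : NCBall d n)
    {F : Matrix (Fin n) (Fin n) ℂ} (hF : HasEval (moments μ) Z F) (i j : Fin n) :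
    μ ⟨(∑' m, zLstar Z ^ m) i j, tsum_zLstar_pow_mem Z i j⟩ = F i j := by
  have h1 : HasSum (fun m => ∑ α ∈ words d m, Z.monomial α i j •
      (⟨lstar α, lstar_mem α⟩ : diskSystem d))
      ⟨(∑' m, zLstar Z ^ m) i j, tsum_zLstar_pow_mem Z i j⟩ := by
    refine (Topology.IsInducing.subtypeVal.hasSum_iff
      (g := (diskSystem d).subtype) _ _).1 ?_
    convert hasSum_zLstar_apply Z i j using 2 with m
    · simp
    · rfl
  have h2 := h1.map μ hμ.continuous
  have h3 : HasSum (fun α => moments μ α * Z.monomial α i j) (F i j) :=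
    Pi.hasSum.1 (Pi.hasSum.1 hF i) j
  refine (hasSum_words_unique h3 ?_).symm
  convert h2 using 2 with m
  rw [Function.comp_apply, map_sum]
  refine Finset.sum_congr rfl fun α _ => ?_
  rw [map_smul, ← moments_apply, smul_eq_mul, mul_comm]

theorem herglotz_formula {μ : diskSystem d →ₗ[ℂ] ℂ} (hμ : IsPos μ) {t : ℝ} {B : FreeFunction d}
    (hη : ∀ n Z, HasEval (herglotzSeries μ t) Z (herglotz B n Z)) (Z : NCBall d n) :
    ∃ M : Matrix (Fin n) (Fin n) (diskSystem d),
      M.map Subtype.val = (1 + zLstar Z) * Ring.inverse (1 - zLstar Z) ∧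
      herglotz B n Z = Complex.I • (imaginaryPart (herglotz B n (NCBall.zero d n)) :
        Matrix (Fin n) (Fin n) ℂ) + M.map μ := by
  obtain ⟨C, hC⟩ := levelBounded_moments hμ
  obtain ⟨F, hF⟩ := hC.exists_hasEval Z
  -- The Cayley transform of `ZL^*` is `2 ∑ (ZL^*)^m - 1`, taken entry by entry.
  refine ⟨Matrix.of fun i j => (2 : ℂ) •
    (⟨(∑' m, zLstar Z ^ m) i j, tsum_zLstar_pow_mem Z i j⟩ : diskSystem d) -
      if i = j then sysOne d else 0, ?_, ?_⟩
  · rw [cayley_zLstar]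
    ext1 i j
    rw [Matrix.map_apply, Matrix.of_apply, Matrix.sub_apply, Matrix.smul_apply, Matrix.one_apply]
    split_ifs <;> simp [sysOne]
  · have h0 : herglotz B n (NCBall.zero d n) = (moments μ 1 + t * Complex.I) • 1 := by
      rw [(hη n _).unique (HasEval.zero_point _ n), herglotzSeries_one]
    have him : (imaginaryPart (herglotz B n (NCBall.zero d n)) : Matrix (Fin n) (Fin n) ℂ) =
        (t : ℂ) • 1 := by
      have h1 : star (moments μ 1) = moments μ 1 := Complex.conj_eq_iff_im.2 (moments_one_im hμ)
      rw [h0, imaginaryPart_apply_coe, star_smul, star_add, h1, star_one, ← sub_smul]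
      ext i j
      simp only [Matrix.smul_apply, smul_eq_mul, Complex.real_smul]
      simp only [Complex.star_def, map_mul, Complex.conj_ofReal, Complex.conj_I]
      push_cast
      linear_combination (-(t : ℂ) * (1 : Matrix (Fin n) (Fin n) ℂ) i j) * Complex.I_sq
    rw [(hη n Z).unique (hasEval_herglotzSeries t hF), him]
    ext i j
    have h1 : μ (sysOne d) = moments μ 1 := by
      rw [moments_apply]
      exact congrArg μ (Subtype.ext lstar_one.symm)
    rw [Matrix.add_apply, Matrix.map_apply, Matrix.of_apply, map_sub, map_smul,
      apply_tsum_zLstar_pow hμ Z hF, Matrix.sub_apply, Matrix.smul_apply, Matrix.smul_apply,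
      Matrix.smul_apply, Matrix.smul_apply, Matrix.one_apply]
    split_ifs
    · rw [h1]; simp only [smul_eq_mul]; ring
    · rw [map_zero]; simp

end Formula
end FreeClark
end

/-! ### Assembly of the theorem. -/

theorem theorem3p2 (d : ℕ) :
    ∃ Φ : FreeClark.CayleySchur d → FreeClark.PositiveFunctional d,
      -- the Cayley transform and the Clark functional of `B` exist, and `Φ B` is the latter
      (∀ B : FreeClark.CayleySchur d,
        (∀ (n : ℕ) (Z : FreeClark.NCBall d n), IsUnit (1 - B.1.val n Z)) ∧
        (FreeClark.rightHerglotz B.1).graph = FreeClark.rightHerglotzGraph B.1 ∧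
        Dense ((FreeClark.rightHerglotz B.1).domain : Set (FreeClark.Fock d)) ∧
        ∀ μ : FreeClark.diskSystem d →ₗ[ℂ] ℂ,
          FreeClark.IsClarkFunctional B.1 μ ↔ μ = (Φ B).1) ∧
      -- `B ↦ μ_B` is onto, and a bijection modulo imaginary constants
      Function.Surjective Φ ∧
      (∀ B B' : FreeClark.CayleySchur d, Φ B = Φ B' ↔
        ∃ t : ℝ, ∀ (n : ℕ) (Z : FreeClark.NCBall d n),
          FreeClark.herglotz B.1 n Z =
            FreeClark.herglotz B'.1 n Z + ((t : ℂ) * Complex.I) • 1) ∧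
      Function.Bijective (fun B : FreeClark.CayleySchur d =>
        ((Φ B, (FreeClark.herglotz B.1 1 (FreeClark.NCBall.zero d 1) 0 0).im) :
          FreeClark.PositiveFunctional d × ℝ)) ∧
      -- the free Herglotz formula
      (∀ (B : FreeClark.CayleySchur d) (n : ℕ) (Z : FreeClark.NCBall d n),
        IsUnit (1 - FreeClark.zLstar Z) ∧
        ∃ M : Matrix (Fin n) (Fin n) (FreeClark.diskSystem d),
          M.map Subtype.val =
            (1 + FreeClark.zLstar Z) * Ring.inverse (1 - FreeClark.zLstar Z) ∧
          FreeClark.herglotz B.1 n Z =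
            Complex.I • (imaginaryPart
              (FreeClark.herglotz B.1 n (FreeClark.NCBall.zero d n)) :
                Matrix (Fin n) (Fin n) ℂ)
            + M.map (Φ B).1) := by
  open FreeClark in
  choose Φ hunit hgraph hdense hclark heval using
    fun B : CayleySchur d => B.exists_functional
  -- The series built from `(μ, t)` and the one attached to `Φ B` have the same values `H_B(Z)`.
  -- They therefore coincide, and a Herglotz series determines both of its parameters.
  have hsurj : ∀ (μ : PositiveFunctional d) (t : ℝ), ∃ B : CayleySchur d, Φ B = μ ∧
      (herglotz B.1 1 (NCBall.zero d 1) 0 0).im = t := by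
    intro μ t
    obtain ⟨B, hB⟩ := exists_cayleySchur μ.2 t
    obtain ⟨h1, h2⟩ := herglotzSeries_injective (Φ B).2 μ.2
      (series_ext fun n Z => ⟨_, heval B n Z, hB n Z⟩)
    exact ⟨B, Subtype.ext h1, h2⟩
  refine ⟨Φ, fun B => ⟨hunit B, hgraph B, hdense B, hclark B⟩, fun μ => ?_, fun B B' => ⟨?_, ?_⟩,
    ⟨fun B B' h => ?_, fun p => ?_⟩, fun B n Z => ⟨isUnit_one_sub_zLstar Z, ?_⟩⟩
  · obtain ⟨B, hB, -⟩ := hsurj μ 0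
    exact ⟨B, hB⟩
  · intro h
    refine ⟨(herglotz B.1 1 (NCBall.zero d 1) 0 0).im -
      (herglotz B'.1 1 (NCBall.zero d 1) 0 0).im, fun n Z => ?_⟩
    have h1 := (heval B' n Z).add (hasEval_one.smul
      ((((herglotz B.1 1 (NCBall.zero d 1) 0 0).im -
        (herglotz B'.1 1 (NCBall.zero d 1) 0 0).im : ℝ) : ℂ) * Complex.I))
    rw [← herglotzSeries_add, add_sub_cancel, ← h] at h1
    exact (heval B n Z).unique h1
  · rintro ⟨t, ht⟩
    -- Adding `it` to `H_{B'}` only shifts the real parameter of its Herglotz series, so the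
    -- functional is unchanged.
    refine Subtype.ext (herglotzSeries_injective (Φ B).2 (Φ B').2
      (t := (herglotz B'.1 1 (NCBall.zero d 1) 0 0).im + t)
      (series_ext fun n Z => ⟨_, heval B n Z, ?_⟩)).1
    rw [herglotzSeries_add, ht n Z]
    exact (heval B' n Z).add (hasEval_one.smul _)
  · obtain ⟨h1, h2⟩ := Prod.mk.inj h
    refine Subtype.ext (FreeFunction.ext ?_)
    funext n Z
    refine val_eq_of_herglotz_eq (hunit B n Z) (hunit B' n Z) ?_
    have h3 := heval B n Z
    rw [h1, h2] at h3
    exact h3.unique (heval B' n Z)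
  · obtain ⟨B, h1, h2⟩ := hsurj p.1 p.2
    exact ⟨B, Prod.ext h1 h2⟩
  · exact herglotz_formula (Φ B).2 (heval B) Z
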